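/- **Algorithm (lean-consensus).** Processes $p_0,p_1,p_2,\dots$ share two infinite arrays $a_0,a_1$ of atomic read/write bits, all initially $0$ except $a_0[0]=a_1[0]=1$. A process with input bit $b$ sets its preference $p:=b$ and its round number $\rho:=1$, and then repeats the following round of four operations: (1) read $a_0[\rho]$; (2) read $a_1[\rho]$, and if for some bit $b$ the values read satisfy $a_b[\rho]=1$ and $a_{1-b}[\rho]=0$, set $p:=b$; (3) write $1$ to $a_p[\rho]$; (4) read $a_{1-p}[\rho-1]$; if the value is $0$, decide $p$ and exit, otherwise set $\rho:=\rho+1$ and repeat. A global state (register contents and local states of all processes) is *reachable* if it arises from an initial state, with arbitrary inputs, by finitely many operations executed in an arbitrary order. **Noisy scheduling with random halting failures.** Fix, for each operation type $\pi\in\{\text{read},\text{write}\}$, a probability distribution $F_\pi$ on the non-negative reals that is not concentrated on a point, a constant $M$, and a function $h:\mathbb N\to[0,1]$. Starting from a given global state, let $A$ be a set of $n$ active processes (none of which has decided); all other processes take no further steps. The adversary chooses real constants $\Delta_{ij}$ for $i\in A$, $j\ge 0$, where the starting times $\Delta_{i0}$ are arbitrary and $0\le\Delta_{ij}\le M$ for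 $j\ge1$. Let $X_{ij}$ and $H_{ij}$ ($i\in A$, $j\ge 1$) be mutually independent random variables, where $X_{ij}$ has distribution $F_\pi$ if the $j$-th operation of $p_i$ from the start is of type $\pi$, and $H_{ij}$ is $\infty$ with probability $h(n)$ and $0$ otherwise. The $j$-th operation of $p_i$, counted from the start, occurs at time $$S'_{ij}=\Delta_{i0}+\sum_{k=1}^{j}\left(\Delta_{ik}+X_{ik}+H_{ik}\right),$$ provided that $p_i$ has not decided before and that $S'_{ij}<\infty$; if $S'_{ij}=\infty$, the process has halted and the operation does not occur. The adversary's choices are required to be such that, with probability $1$, no two operations of distinct processes have the same finite time $S'_{ij}=S'_{i'j'}$. Operations are executed in order of their times, those of the same process in order of their index $j$. The algorithm *terminates by round $R$* if after finitely many operations every active process has decided or halted, and no operation was executed (after the start) by a process whose round number was larger than $R$. **Theorem.** For all $F_{\mathrm{read}},F_{\mathrm{write}}$, $M$ and $h$ as above there is a constant $C>0$, depending only on these data, such that the following holds for every $n\ge 2$, every reachable state, every set $A$ of $n$ active processes in it, and every choice of the $\Delta_{ij}$ as above. Let $r$ be the largest round number of any process in the starting state, and let $r'\in\{0,1,2,\dots\}\cup\{\infty\}$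 be the least number such that the algorithm, started from this state, terminates by round $r+r'$. Then $$\mathbb E[r']\le C\log n\qquad\text{and}\qquad \Pr[r'>k]\le e^{-\lfloor k/(C\log n)\rfloor}\quad\text{for every real } k\ge0 .$$ -/

import Mathlib

open MeasureTheory ProbabilityTheory
open scoped ENNReal

namespace NoisyConsensus

/-! ## The algorithm

Processes are numbered by `ℕ`; bits are `Bool`, with `false` for `0` and `true` for `1`. -/

/-- The two types of operations on the shared registers. -/
inductive OpType where
  | read
  | write

/-- Which operation a process executes next within its current round (or that it has exited).
`readOne v` carries the value `v` that the process has just read from `a₀[r]`. -/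
inductive Loc where
  | readZero
  | readOne (v : Bool)
  | writePref
  | readRival
  | decided

/-- Position in the fixed sequence of four operations of a round. -/
def Loc.stage : Loc → ℕ
  | .readZero => 0
  | .readOne _ => 1
  | .writePref => 2
  | .readRival => 3
  | .decided => 0

/-- The type of the `j`-th operation (`j ≥ 1`) that a process now at location `l` will execute,
counted from now: each round consists of two reads, a write and another read. -/
def opType (l : Loc) (j : ℕ) : OpType :=
  if (l.stage + j) % 4 = 3 then .write else .read

/-- The local state of a process. In location `decided`, `pref` is the decision value. -/
structure ProcState where
  pref : Bool
  round : ℕ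
  loc : Loc

/-- A global state: `mem b r` is the content of register `a_b[r]`. -/
structure Config where
  mem : Bool → ℕ → Bool
  proc : ℕ → ProcState

/-- The initial state for given input bits: all registers are `0`, except for the read-only prefix
`a₀[0] = a₁[0] = 1`. -/
def Config.init (input : ℕ → Bool) : Config where
  mem := fun _ r => decide (r = 0)
  proc := fun i => ⟨input i, 1, .readZero⟩

/-- The new preference after reading `v₀` from `a₀[r]` and `v₁` from `a₁[r]`. -/
def newPref (v₀ v₁ pref : Bool) : Bool :=
  match v₀, v₁ with
  | true, false => false
  | false, true => true
  | _, _ => pref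

/-- Replace the local state of process `i`. -/
def Config.setProc (c : Config) (i : ℕ) (p : ProcState) : Config :=
  ⟨c.mem, Function.update c.proc i p⟩

/-- Set register `a_b[r]` to `1`. -/
def Config.mark (c : Config) (b : Bool) (r : ℕ) : Config :=
  ⟨Function.update c.mem b (Function.update (c.mem b) r true), c.proc⟩

/-- Process `i` executes its next operation, with the local computation that follows it.
A process that has decided does nothing. -/
def Config.step (c : Config) (i : ℕ) : Config :=
  let p := c.proc i
  match p.loc with
  | .readZero => c.setProc i ⟨p.pref, p.round, .readOne (c.mem false p.round)⟩
  | .readOne v => c.setProc i ⟨newPref v (c.mem true p.round) p.pref, p.round, .writePref⟩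
  | .writePref => (c.mark p.pref p.round).setProc i ⟨p.pref, p.round, .readRival⟩
  | .readRival =>
      if c.mem (!p.pref) (p.round - 1) = false then c.setProc i ⟨p.pref, p.round, .decided⟩
      else c.setProc i ⟨p.pref, p.round + 1, .readZero⟩
  | .decided => c

/-- The states that can arise from some initial state by finitely many operations, executed in
any order. -/
inductive Reachable : Config → Prop
  | init (input : ℕ → Bool) : Reachable (Config.init input)
  | step {c : Config} (i : ℕ) : Reachable c → Reachable (c.step i)

/-! ## Execution of a timetable

`T i j` is the time of the `j`-th operation (`j ≥ 1`) of process `i`, counted from the start;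
it is `⊤` if process `i` halts before that operation. Only the processes in the finite set `A`
take steps. -/

/-- A state of a running execution, with the number of operations each process has executed. -/
structure RunState where
  cfg : Config
  count : ℕ → ℕ

open Classical in
/-- The processes in `A` that will execute a further operation: they have neither decided nor
halted. -/
noncomputable def pending (A : Finset ℕ) (T : ℕ → ℕ → EReal) (s : RunState) : Finset ℕ :=
  A.filter fun i => (s.cfg.proc i).loc ≠ .decided ∧ T i (s.count i + 1) ≠ ⊤

open Classical in
/-- The pending processes whose next operation comes first. -/
noncomputable def earliest (A : Finset ℕ) (T : ℕ → ℕ → EReal) (s : RunState) : Finset ℕ :=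
  (pending A T s).filter fun i => ∀ k ∈ pending A T s, T i (s.count i + 1) ≤ T k (s.count k + 1)

open Classical in
/-- The process that executes the next operation, if there is one. (Two processes are never
scheduled for the same time, except with probability zero; such ties go to the smaller index.) -/
noncomputable def mover (A : Finset ℕ) (T : ℕ → ℕ → EReal) (s : RunState) : Option ℕ :=
  if hs : (earliest A T s).Nonempty then some ((earliest A T s).min' hs) else none

/-- One step of the execution. -/
noncomputable def RunState.next (A : Finset ℕ) (T : ℕ → ℕ → EReal) (s : RunState) : RunState :=
  match mover A T s with
  | some i => ⟨s.cfg.step i, Function.update s.count i (s.count i + 1)⟩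
  | none => s

/-- The state after `m` operations, starting from the state `c`. -/
noncomputable def run (A : Finset ℕ) (T : ℕ → ℕ → EReal) (c : Config) : ℕ → RunState
  | 0 => ⟨c, fun _ => 0⟩
  | m + 1 => (run A T c m).next A T

/-- The execution from `c` terminates by round `R`: after finitely many operations every process
in `A` has decided or halted, and no operation was executed in a round later than `R`. -/
def TerminatesBy (A : Finset ℕ) (T : ℕ → ℕ → EReal) (c : Config) (R : ℕ) : Prop :=
  ∃ m : ℕ, pending A T (run A T c m) = ∅ ∧
    ∀ m' < m, ∀ i, mover A T (run A T c m') = some i → ((run A T c m').cfg.proc i).round ≤ R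

/-- The least `r'` such that the execution from `c` terminates by round `r + r'`
(`⊤` if there is none). -/
noncomputable def extraRounds (A : Finset ℕ) (T : ℕ → ℕ → EReal) (c : Config) (r : ℕ) : ℕ∞ :=
  sInf {x : ℕ∞ | ∃ k : ℕ, x = k ∧ TerminatesBy A T c (r + k)}

/-! ## Noisy scheduling with random halting failures -/

/-- The time `S'_{ij} = Δ_{i0} + ∑_{k=1}^{j} (Δ_{ik} + X_{ik} + H_{ik})` of process `i`'s `j`-th
operation, on the sample point `ω`. -/
noncomputable def opTime {Ω : Type*} (Δ : ℕ → ℕ → ℝ) (X : ℕ → ℕ → Ω → ℝ) (H : ℕ → ℕ → Ω → EReal)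
    (ω : Ω) (i j : ℕ) : EReal :=
  (Δ i 0 : EReal) + ∑ k ∈ Finset.Icc 1 j, ((Δ i k : EReal) + (X i k ω : EReal) + H i k ω)

/-- Adversarial delays `Δ`, noise `X` and failures `H` form a noisy schedule for the processes in
`A` starting from the state `c`, with noise distributions `F`, delay bound `M` and failure
probability `p` per operation. -/
structure IsNoisySchedule {Ω : Type*} [MeasurableSpace Ω] (μ : Measure Ω)
    (F : OpType → Measure ℝ) (M p : ℝ) (c : Config) (A : Finset ℕ)
    (Δ : ℕ → ℕ → ℝ) (X : ℕ → ℕ → Ω → ℝ) (H : ℕ → ℕ → Ω → EReal) : Prop where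
  /-- Delays are non-negative and at most `M`; the starting times `Δ i 0` are arbitrary. -/
  delay_mem : ∀ i ∈ A, ∀ j, 1 ≤ j → Δ i j ∈ Set.Icc 0 M
  measurable_noise : ∀ i ∈ A, ∀ j, 1 ≤ j → Measurable (X i j)
  /-- The noise of an operation of type `π` has law `F π`. -/
  law_noise : ∀ i ∈ A, ∀ j, 1 ≤ j → μ.map (X i j) = F (opType (c.proc i).loc j)
  measurable_halt : ∀ i ∈ A, ∀ j, 1 ≤ j → Measurable (H i j)
  halt_eq : ∀ i ∈ A, ∀ j, 1 ≤ j → ∀ ω, H i j ω = 0 ∨ H i j ω = ⊤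
  /-- Each process halts before each of its operations with probability `p`. -/
  prob_halt : ∀ i ∈ A, ∀ j, 1 ≤ j → μ {ω | H i j ω = ⊤} = ENNReal.ofReal p
  /-- All the variables `X i j` and `H i j`, for `i ∈ A` and `j ≥ 1`, are independent. -/
  indep : iIndepFun
    (Sum.elim (fun (q : A × ℕ) (ω : Ω) => (X q.1 (q.2 + 1) ω : EReal))
      (fun (q : A × ℕ) (ω : Ω) => H q.1 (q.2 + 1) ω)) μ
  /-- Almost surely, no two operations of distinct processes occur at the same time. -/
  no_ties : ∀ i ∈ A, ∀ i' ∈ A, i ≠ i' → ∀ j j', 1 ≤ j → 1 ≤ j' →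
    μ {ω | opTime Δ X H ω i j = opTime Δ X H ω i' j' ∧ opTime Δ X H ω i j ≠ ⊤} = 0

end NoisyConsensus

/-
Call a process a leader in round `R` if it executes its third operation of round `R` before any
other process executes its first. By then it has written to its preferred array at `R`, everybody
else sees the other array empty there and adopts its preference, and no round after `R + 1` is
entered; the same holds if everybody halts before round `R`.

Cut the execution into blocks of `Θ(log n)` rounds. Each block produces a leader in its last round
with probability at least some `ε > 0`, whatever happened before, and the geometric decay over the
blocks gives both bounds. For the claim on a single block, compare the time `S` of the first and `W`
of the third operation of a process in the last round of the block. At the time `t` by which the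
expected number of processes with `S ≤ t` is about one half, the probability that exactly one
process has `S ≤ t` is bounded below, so it suffices that `W ≤ t - 1` and `S ≤ t` have comparable
probability. This is where randomness of the noise enters: a block contains order `log n`
independent reads, so up to an error `O(1 / n)` many of them are slow, and replacing boundedly many
slow reads by fast ones moves the whole sum down by a constant at the price of a constant factor in
probability.
-/

namespace NoisyConsensus

/-! ## Reachable states -/

/-- The local state of a process after its next operation, executed with register contents
`mem`. -/
def localStep (mem : Bool → ℕ → Bool) (p : ProcState) : ProcState :=
  match p.loc with
  | .readZero => ⟨p.pref, p.round, .readOne (mem false p.round)⟩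
  | .readOne v => ⟨newPref v (mem true p.round) p.pref, p.round, .writePref⟩
  | .writePref => ⟨p.pref, p.round, .readRival⟩
  | .readRival =>
      if mem (!p.pref) (p.round - 1) = false then ⟨p.pref, p.round, .decided⟩
      else ⟨p.pref, p.round + 1, .readZero⟩
  | .decided => p

theorem proc_step (c : Config) (i : ℕ) :
    (c.step i).proc = Function.update c.proc i (localStep c.mem (c.proc i)) := by
  unfold Config.step localStep
  rcases hl : (c.proc i).loc with _ | v | _ | _ | _ <;> simp only [hl, Config.setProc, Config.mark]
  case readRival => split_ifs <;> rfl
  case decided => exact (Function.update_eq_self i c.proc).symm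

theorem proc_step_self (c : Config) (i : ℕ) :
    (c.step i).proc i = localStep c.mem (c.proc i) := by
  rw [proc_step, Function.update_self]

theorem proc_step_of_ne (c : Config) {i j : ℕ} (h : j ≠ i) : (c.step i).proc j = c.proc j := by
  rw [proc_step, Function.update_of_ne h]

theorem mem_step_iff (c : Config) (i : ℕ) (b : Bool) (ρ : ℕ) :
    (c.step i).mem b ρ = true ↔ c.mem b ρ = true ∨
      ((c.proc i).loc = .writePref ∧ (c.proc i).pref = b ∧ (c.proc i).round = ρ) := by
  unfold Config.step
  rcases hl : (c.proc i).loc with _ | v | _ | _ | _ <;> simp only [hl, Config.setProc, Config.mark]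
  case readRival => split_ifs <;> simp
  case writePref =>
    by_cases hb : b = (c.proc i).pref
    · subst hb
      by_cases hρ : ρ = (c.proc i).round
      · simp [hρ]
      · simp [hρ, Ne.symm hρ]
    · simp [hb, Ne.symm hb]
  all_goals simp

theorem mem_le_mem_step (c : Config) (i : ℕ) : c.mem ≤ (c.step i).mem := fun b ρ =>
  Bool.le_iff_imp.2 fun h => (mem_step_iff c i b ρ).2 (Or.inl h)

theorem round_le_round_localStep (mem : Bool → ℕ → Bool) (p : ProcState) :
    p.round ≤ (localStep mem p).round := by
  unfold localStep
  split <;> try split_ifs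
  all_goals simp

theorem round_le_round_step (c : Config) (i j : ℕ) :
    (c.proc j).round ≤ ((c.step i).proc j).round := by
  rcases eq_or_ne j i with rfl | hj
  · rw [proc_step_self]
    exact round_le_round_localStep _ _
  · rw [proc_step_of_ne c hj]

/-- The local state `p` is consistent with the register contents `mem`: what the process has read
or written is still there. For a process in round `1`, `round - 2` truncates to `0`. -/
structure ProcState.Consistent (mem : Bool → ℕ → Bool) (p : ProcState) : Prop where
  round_pos : 1 ≤ p.round
  pref_prev : mem p.pref (p.round - 1) = true
  mem_passed : ∀ b, mem b (p.round - 2) = true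
  readOne_mem : p.loc = .readOne true → mem false p.round = true
  readRival_mem : p.loc = .readRival → mem p.pref p.round = true

theorem ProcState.Consistent.mono {mem mem' : Bool → ℕ → Bool} {p : ProcState}
    (h : p.Consistent mem) (hle : mem ≤ mem') : p.Consistent mem' where
  round_pos := h.round_pos
  pref_prev := Bool.le_iff_imp.1 (hle _ _) h.pref_prev
  mem_passed b := Bool.le_iff_imp.1 (hle _ _) (h.mem_passed b)
  readOne_mem hl := Bool.le_iff_imp.1 (hle _ _) (h.readOne_mem hl)
  readRival_mem hl := Bool.le_iff_imp.1 (hle _ _) (h.readRival_mem hl)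

theorem newPref_eq_or (v w pref : Bool) :
    newPref v w pref = pref ∨ newPref v w pref = false ∧ v = true ∨
      newPref v w pref = true ∧ w = true := by
  cases v <;> cases w <;> simp [newPref]

theorem ProcState.Consistent.step {c : Config} {i : ℕ} (hc : (c.proc i).Consistent c.mem)
    (hmem : ∀ b, Antitone (c.mem b)) : ((c.step i).proc i).Consistent (c.step i).mem := by
  obtain ⟨hpos, hprev, hpassed, hone, hrival⟩ := hc.mono (mem_le_mem_step c i)
  have hpref : (c.step i).mem (localStep c.mem (c.proc i)).pref ((c.proc i).round - 1) = true := by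
    unfold localStep
    split <;> try split_ifs
    case h_2 v hl =>
      rcases newPref_eq_or v (c.mem true (c.proc i).round) (c.proc i).pref with
        h | ⟨h, hv⟩ | ⟨h, hw⟩
      · rwa [h]
      · rw [h]
        have hread := hc.readOne_mem (hv ▸ hl)
        exact Bool.le_iff_imp.1 ((hmem _ (Nat.sub_le _ 1)).trans (mem_le_mem_step c i _ _)) hread
      · rw [h]
        exact Bool.le_iff_imp.1 ((hmem _ (Nat.sub_le _ 1)).trans (mem_le_mem_step c i _ _)) hw
    all_goals exact hprev
  rw [proc_step_self]
  unfold localStep at hpref ⊢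
  rcases hl : (c.proc i).loc with _ | v | _ | _ | _ <;> simp only [hl] at hpref ⊢
  case readZero =>
    refine ⟨hpos, hpref, hpassed, fun hv => ?_, nofun⟩
    exact Bool.le_iff_imp.1 (mem_le_mem_step c i _ _) (Loc.readOne.inj hv)
  case readOne => exact ⟨hpos, hpref, hpassed, nofun, nofun⟩
  case writePref =>
    exact ⟨hpos, hpref, hpassed, nofun, fun _ => (mem_step_iff _ _ _ _).2 (Or.inr ⟨hl, rfl, rfl⟩)⟩
  case readRival =>
    split_ifs with hm
    · exact ⟨hpos, hprev, hpassed, nofun, nofun⟩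
    · have hrival_prev :=
        Bool.le_iff_imp.1 (mem_le_mem_step c i _ _) (Bool.eq_true_of_not_eq_false hm)
      refine ⟨by simp, hrival hl, fun b => ?_, nofun, nofun⟩
      rcases b.eq_or_eq_not (c.proc i).pref with rfl | rfl
      exacts [hprev, hrival_prev]
  case decided => exact ⟨hpos, hprev, hpassed, hone, hrival⟩

/-- The invariant of all reachable states: each array is a block of `1`s followed by `0`s, written
by processes that have got that far, and every process is consistent with the registers. -/
structure Config.WellFormed (c : Config) : Prop where
  mem_antitone : ∀ b, Antitone (c.mem b)
  exists_le_round : ∀ b ρ, c.mem b ρ = true → ∃ i, ρ ≤ (c.proc i).round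
  consistent : ∀ i, (c.proc i).Consistent c.mem

theorem Config.WellFormed.init (input : ℕ → Bool) : (Config.init input).WellFormed where
  mem_antitone _ := antitone_nat_of_succ_le fun _ => by simp [Config.init]
  exists_le_round _ _ h := ⟨0, by simp_all [Config.init]⟩
  consistent _ := ⟨le_rfl, rfl, fun _ => rfl, nofun, nofun⟩

theorem Config.WellFormed.step {c : Config} (hc : c.WellFormed) (i : ℕ) :
    (c.step i).WellFormed where
  mem_antitone b := antitone_nat_of_succ_le fun ρ => Bool.le_iff_imp.2 fun h => by
    apply Bool.le_iff_imp.1 (mem_le_mem_step c i b ρ)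
    rcases (mem_step_iff c i b (ρ + 1)).1 h with h | ⟨-, rfl, hρ⟩
    · exact Bool.le_iff_imp.1 (hc.mem_antitone b ρ.le_succ) h
    · simpa [hρ] using (hc.consistent i).pref_prev
  exists_le_round b ρ h := by
    rcases (mem_step_iff c i b ρ).1 h with h | ⟨-, -, rfl⟩
    · obtain ⟨j, hj⟩ := hc.exists_le_round b ρ h
      exact ⟨j, hj.trans (round_le_round_step c i j)⟩
    · exact ⟨i, round_le_round_step c i i⟩
  consistent j := by
    rcases eq_or_ne j i with rfl | hj
    · exact (hc.consistent j).step hc.mem_antitone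
    · rw [proc_step_of_ne c hj]
      exact (hc.consistent j).mono (mem_le_mem_step c i)

theorem Reachable.wellFormed {c : Config} (hc : Reachable c) : c.WellFormed := by
  induction hc with
  | init input => exact .init input
  | step i _ ih => exact ih.step i

/-! ## Locked rounds -/

/-- The position of a local state in the sequence of all operations of a process. -/
def ProcState.pos (p : ProcState) : ℕ := 4 * p.round + p.loc.stage

theorem Loc.stage_lt (l : Loc) : l.stage < 4 := by
  cases l <;> simp [Loc.stage]

theorem pos_localStep_le (mem : Bool → ℕ → Bool) (p : ProcState) :
    (localStep mem p).pos ≤ p.pos + 1 := by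
  unfold localStep
  rcases hl : p.loc with _ | v | _ | _ | _ <;> simp only
  case readRival => split_ifs <;> grind [ProcState.pos, Loc.stage]
  all_goals simp [ProcState.pos, Loc.stage, hl]

theorem loc_ne_decided_and_pos_localStep {mem : Bool → ℕ → Bool} {p : ProcState}
    (h : (localStep mem p).loc ≠ .decided) :
    p.loc ≠ .decided ∧ (localStep mem p).pos = p.pos + 1 := by
  revert h
  unfold localStep
  rcases hl : p.loc with _ | v | _ | _ | _ <;> simp only
  case readRival =>
    split_ifs
    · simp
    · grind [ProcState.pos, Loc.stage]
  all_goals simp [ProcState.pos, Loc.stage, hl]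

theorem rival_unset_of_localStep_decided {mem : Bool → ℕ → Bool} {p : ProcState}
    (hp : p.loc ≠ .decided) (h : (localStep mem p).loc = .decided) :
    p.loc = .readRival ∧ mem (!p.pref) (p.round - 1) = false := by
  revert h
  unfold localStep
  rcases hl : p.loc with _ | v | _ | _ | _ <;> simp only
  case readRival => split_ifs with hm <;> simp [hm]
  all_goals simp_all

/-- Whatever the process reads when `a_b[R] = 1` and `a_{1-b}[R] = a_{1-b}[R+1] = 0`, it will
write `b` in rounds `R` and `R + 1` and not get further. -/
structure ProcState.Committed (p : ProcState) (b : Bool) (R : ℕ) : Prop where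
  round_le : p.round ≤ R + 1
  readOne : ∀ v, p.loc = .readOne v → p.round = R → newPref v b p.pref = b
  readOne_succ : p.loc = .readOne true → p.round = R + 1 → b = false
  pref_eq : 4 * R + 2 ≤ p.pos → p.pref = b

/-- Only the bit `b` is written from round `R` on, so that every process decides by round
`R + 1`. -/
structure Config.Locked (c : Config) (b : Bool) (R : ℕ) : Prop where
  mem_win : c.mem b R = true
  mem_lose : c.mem (!b) R = false
  mem_lose_succ : c.mem (!b) (R + 1) = false
  committed : ∀ i, (c.proc i).Committed b R

theorem ProcState.Committed.localStep {mem : Bool → ℕ → Bool} {p : ProcState} {b : Bool} {R : ℕ}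
    (hp : p.Committed b R) (hwin : mem b R = true) (hlose : mem (!b) R = false)
    (hlose_succ : mem (!b) (R + 1) = false) : (localStep mem p).Committed b R := by
  obtain ⟨hround, hone, hone_succ, hpref⟩ := hp
  unfold NoisyConsensus.localStep
  rcases hl : p.loc with _ | v | _ | _ | _ <;>
    simp only [hl, ProcState.pos, Loc.stage] at hone hone_succ hpref ⊢
  case readZero =>
    refine ⟨hround, ?_, ?_, ?_⟩ <;> cases b <;> grind [newPref, ProcState.pos, Loc.stage]
  case readOne =>
    refine ⟨hround, nofun, nofun, fun hpos => ?_⟩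
    have hread : p.round = R → mem true p.round = b := by cases b <;> simp_all
    rcases (show p.round = R ∨ p.round = R + 1 by simp only [pos, Loc.stage] at hpos; omega)
      with h | h
    · rw [hread h, hone v rfl h]
    · rw [h, hpref (by omega)]
      rcases newPref_eq_or v (mem true (R + 1)) b with h' | ⟨h', hv⟩ | ⟨h', hw⟩
      · exact h'
      · rw [h', hone_succ (by rw [hv]) h]
      · rw [h']
        cases b <;> simp_all
  case writePref =>
    refine ⟨hround, nofun, nofun, fun hpos => hpref ?_⟩
    simp only [pos, Loc.stage] at hpos
    omega
  case readRival => split_ifs <;> constructor <;> grind [ProcState.pos, Loc.stage]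
  case decided =>
    exact ⟨hround, by simp [hl], by simp [hl], by simpa only [pos, hl, Loc.stage] using hpref⟩

theorem Config.Locked.step {c : Config} {b : Bool} {R : ℕ} (hc : c.Locked b R) (i : ℕ) :
    (c.step i).Locked b R := by
  have mem_lose_step : ∀ ρ, R ≤ ρ → c.mem (!b) ρ = false → (c.step i).mem (!b) ρ = false := by
    intro ρ hρ h
    rw [← Bool.not_eq_true, mem_step_iff]
    rintro (hm | ⟨hl, hb, hr⟩)
    · exact Bool.false_ne_true (h.symm.trans hm)
    · rw [(hc.committed i).pref_eq (by simp only [ProcState.pos, hl, hr, Loc.stage]; omega)] at hb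
      exact (Bool.not_ne_self b).symm hb
  refine ⟨(mem_step_iff _ _ _ _).2 (Or.inl hc.mem_win), mem_lose_step R le_rfl hc.mem_lose,
    mem_lose_step _ R.le_succ hc.mem_lose_succ, fun j => ?_⟩
  rcases eq_or_ne j i with rfl | hj
  · rw [proc_step_self]
    exact (hc.committed j).localStep hc.mem_win hc.mem_lose hc.mem_lose_succ
  · rw [proc_step_of_ne c hj]
    exact hc.committed j

theorem newPref_self (v b : Bool) : newPref v b b = b := by
  cases v <;> cases b <;> rfl

theorem Config.WellFormed.locked {c : Config} (hc : c.WellFormed) {i : ℕ}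
    (hl : (c.proc i).loc = .readRival)
    (hm : c.mem (!(c.proc i).pref) ((c.proc i).round - 1) = false) :
    c.Locked (c.proc i).pref (c.proc i).round := by
  set b := (c.proc i).pref
  set R := (c.proc i).round
  have rival_unset : ∀ ρ, R - 1 ≤ ρ → c.mem (!b) ρ = false := fun ρ hρ =>
    Bool.eq_false_of_le_false (hm ▸ hc.mem_antitone (!b) hρ)
  have pref_eq : ∀ j, R ≤ (c.proc j).round → (c.proc j).pref = b := by
    intro j hj
    by_contra hne
    have hprev := (hc.consistent j).pref_prev
    rw [Bool.eq_not_of_ne hne, rival_unset _ (Nat.sub_le_sub_right hj 1)] at hprev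
    exact Bool.false_ne_true hprev
  refine ⟨(hc.consistent i).readRival_mem hl, rival_unset _ (Nat.sub_le R 1),
    rival_unset _ (by omega), fun j => ⟨?_, ?_, ?_, ?_⟩⟩
  · by_contra! hj
    have hpassed := (hc.consistent j).mem_passed (!b)
    rw [rival_unset _ (by omega)] at hpassed
    exact Bool.false_ne_true hpassed
  · intro v _ hj
    rw [pref_eq j hj.ge, newPref_self]
  · intro hv hj
    have hread := (hc.consistent j).readOne_mem hv
    by_contra hb
    rw [Bool.not_eq_false] at hb
    have hunset := rival_unset (c.proc j).round (by omega)
    rw [hb, Bool.not_true, hread] at hunset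
    exact Bool.true_eq_false_eq_False hunset
  · intro hpos
    refine pref_eq j ?_
    have := (c.proc j).loc.stage_lt
    simp only [ProcState.pos] at hpos
    omega

/-- Process `i` has not yet written in round `R`, and no other process has taken a step in it. -/
structure Config.AheadOf (c : Config) (i R : ℕ) : Prop where
  mem_unset : ∀ b ρ, R ≤ ρ → c.mem b ρ = false
  loc_ne_decided : (c.proc i).loc ≠ .decided
  pos_le : (c.proc i).pos ≤ 4 * R + 2
  pos_le_of_ne : ∀ k ≠ i, (c.proc k).pos ≤ 4 * R

theorem mem_step_eq_false {c : Config} {k R : ℕ} (hmem : ∀ b ρ, R ≤ ρ → c.mem b ρ = false)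
    (hk : (c.proc k).pos < 4 * R + 2) (b : Bool) (ρ : ℕ) (hρ : R ≤ ρ) :
    (c.step k).mem b ρ = false := by
  rw [← Bool.not_eq_true, mem_step_iff]
  rintro (h | ⟨hl, -, hr⟩)
  · exact Bool.false_ne_true ((hmem b ρ hρ).symm.trans h)
  · simp only [ProcState.pos, hl, hr, Loc.stage] at hk
    omega

theorem Config.AheadOf.step_of_ne {c : Config} {i k R : ℕ} (hc : c.AheadOf i R) (hki : k ≠ i)
    (hk : (c.proc k).pos < 4 * R) : (c.step k).AheadOf i R where
  mem_unset := mem_step_eq_false hc.mem_unset (by omega)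
  loc_ne_decided := by
    rw [proc_step_of_ne c hki.symm]
    exact hc.loc_ne_decided
  pos_le := by
    rw [proc_step_of_ne c hki.symm]
    exact hc.pos_le
  pos_le_of_ne j hj := by
    rcases eq_or_ne j k with rfl | hjk
    · rw [proc_step_self]
      exact (pos_localStep_le _ _).trans hk
    · rw [proc_step_of_ne c hjk]
      exact hc.pos_le_of_ne j hj

theorem Config.AheadOf.locked_step {c : Config} {i R : ℕ} (hc : c.AheadOf i R)
    (hpos : (c.proc i).pos = 4 * R + 2) : (c.step i).Locked (c.proc i).pref R := by
  have hround : (c.proc i).round = R := by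
    have := (c.proc i).loc.stage_lt
    simp only [ProcState.pos] at hpos
    omega
  have hl : (c.proc i).loc = .writePref := by
    rcases hl : (c.proc i).loc with _ | v | _ | _ | _ <;>
      simp only [ProcState.pos, hround, hl, Loc.stage] at hpos ⊢ <;> omega
  have hself : (c.step i).proc i = ⟨(c.proc i).pref, R, .readRival⟩ := by
    rw [proc_step_self, localStep, hl, hround]
  have mem_lose : ∀ ρ, R ≤ ρ → (c.step i).mem (!(c.proc i).pref) ρ = false := by
    intro ρ hρ
    rw [← Bool.not_eq_true, mem_step_iff, hc.mem_unset _ _ hρ]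
    simp
  refine ⟨(mem_step_iff _ _ _ _).2 (Or.inr ⟨hl, rfl, hround⟩), mem_lose _ le_rfl,
    mem_lose _ R.le_succ, fun j => ?_⟩
  rcases eq_or_ne j i with rfl | hj
  · rw [hself]
    exact ⟨R.le_succ, nofun, nofun, fun _ => rfl⟩
  · rw [proc_step_of_ne c hj]
    have hle := hc.pos_le_of_ne j hj
    constructor <;> grind [ProcState.pos, Loc.stage]

theorem Config.AheadOf.step_self {c : Config} {i R : ℕ} (hc : c.AheadOf i R)
    (hwf : c.WellFormed) :
    (c.step i).AheadOf i R ∨ ∃ b, ∃ R' ≤ R, (c.step i).Locked b R' := by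
  by_cases hdec : (localStep c.mem (c.proc i)).loc = .decided
  · obtain ⟨hl, hm⟩ := rival_unset_of_localStep_decided hc.loc_ne_decided hdec
    refine Or.inr ⟨_, _, ?_, (hwf.locked hl hm).step i⟩
    have := hc.pos_le
    simp only [ProcState.pos] at this
    omega
  rcases hc.pos_le.lt_or_eq with hlt | heq
  · refine Or.inl ⟨mem_step_eq_false hc.mem_unset hlt, ?_, ?_, fun k hk => ?_⟩
    · rwa [proc_step_self]
    · rw [proc_step_self]
      exact (pos_localStep_le _ _).trans hlt
    · rw [proc_step_of_ne c hk]
      exact hc.pos_le_of_ne k hk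
  · exact Or.inr ⟨_, R, le_rfl, hc.locked_step heq⟩

theorem pos_lt_of_round_lt {p : ProcState} {R : ℕ} (h : p.round < R) : p.pos < 4 * R := by
  have := p.loc.stage_lt
  simp only [ProcState.pos]
  omega

theorem Config.WellFormed.aheadOf {c : Config} (hc : c.WellFormed) {R : ℕ}
    (hR : ∀ k, (c.proc k).round < R) {i : ℕ} (hi : (c.proc i).loc ≠ .decided) :
    c.AheadOf i R where
  mem_unset b ρ hρ := by
    by_contra h
    obtain ⟨k, hk⟩ := hc.exists_le_round b ρ (Bool.eq_true_of_not_eq_false h)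
    exact (hR k).not_ge (hρ.trans hk)
  loc_ne_decided := hi
  pos_le := (pos_lt_of_round_lt (hR i)).le.trans (Nat.le_add_right _ 2)
  pos_le_of_ne k _ := (pos_lt_of_round_lt (hR k)).le

/-! ## Executions -/

section Execution

variable {A : Finset ℕ} {T : ℕ → ℕ → EReal} {s : RunState} {c : Config} {i R : ℕ}

theorem mem_pending :
    i ∈ pending A T s ↔ i ∈ A ∧ (s.cfg.proc i).loc ≠ .decided ∧ T i (s.count i + 1) ≠ ⊤ := by
  simp [pending]

theorem mover_spec (h : mover A T s = some i) : i ∈ pending A T s ∧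
    ∀ k ∈ pending A T s, T i (s.count i + 1) ≤ T k (s.count k + 1) := by
  unfold mover at h
  split_ifs at h with hs
  have hmin := Finset.min'_mem _ hs
  rw [Option.some.inj h] at hmin
  simpa [earliest] using hmin

theorem pending_eq_empty_of_mover_eq_none (h : mover A T s = none) : pending A T s = ∅ := by
  unfold mover at h
  split_ifs at h with hs
  by_contra hne
  obtain ⟨i, hi, hmin⟩ := Finset.exists_min_image (pending A T s) (fun i => T i (s.count i + 1))
    (Finset.nonempty_iff_ne_empty.2 hne)
  exact hs ⟨i, by simpa [earliest] using ⟨hi, hmin⟩⟩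

/-- The running execution after a further operation of process `i`. -/
def RunState.advance (s : RunState) (i : ℕ) : RunState :=
  ⟨s.cfg.step i, Function.update s.count i (s.count i + 1)⟩

theorem run_succ_of_mover_eq_some {m : ℕ} (h : mover A T (run A T c m) = some i) :
    run A T c (m + 1) = (run A T c m).advance i := by
  simp only [run, RunState.next, h, RunState.advance]

theorem run_induction {P : RunState → Prop} (zero : P ⟨c, fun _ => 0⟩)
    (advance : ∀ m i, mover A T (run A T c m) = some i → P (run A T c m) →
      P ((run A T c m).advance i)) (m : ℕ) : P (run A T c m) := by
  induction m with
  | zero => exact zero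
  | succ m ih =>
    rcases h : mover A T (run A T c m) with _ | i
    · simpa only [run, RunState.next, h] using ih
    · exact run_succ_of_mover_eq_some h ▸ advance m i h ih

theorem pos_run (m : ℕ) (h : ((run A T c m).cfg.proc i).loc ≠ .decided) :
    ((run A T c m).cfg.proc i).pos = (c.proc i).pos + (run A T c m).count i := by
  refine run_induction (P := fun s => (s.cfg.proc i).loc ≠ .decided →
    (s.cfg.proc i).pos = (c.proc i).pos + s.count i) (fun _ => rfl) (fun m k _ ih => ?_) m h
  rcases eq_or_ne i k with rfl | hik
  · simp only [RunState.advance, proc_step_self, Function.update_self]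
    intro h
    obtain ⟨hloc, hpos⟩ := loc_ne_decided_and_pos_localStep h
    rw [hpos, ih hloc, add_assoc]
  · simpa only [RunState.advance, proc_step_of_ne _ hik, Function.update_of_ne hik] using ih

theorem Config.WellFormed.run (hc : c.WellFormed) (m : ℕ) :
    (NoisyConsensus.run A T c m).cfg.WellFormed :=
  run_induction (P := fun s => s.cfg.WellFormed) hc (fun _ k _ ih => ih.step k) m

theorem count_run_le (h : ∀ m i, ((run A T c m).cfg.proc i).round ≤ R) (m : ℕ) :
    (run A T c m).count i ≤ 4 * R + 4 := by
  refine run_induction (P := fun s => s.count i ≤ 4 * R + 4) (Nat.zero_le _)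
    (fun m k hk ih => ?_) m
  rcases eq_or_ne i k with rfl | hik
  · have hpos := pos_run m (mem_pending.1 (mover_spec hk).1).2.1
    have hstage := ((run A T c m).cfg.proc i).loc.stage_lt
    have hround := h m i
    simp only [RunState.advance, Function.update_self]
    simp only [ProcState.pos] at hpos
    omega
  · simpa only [RunState.advance, Function.update_of_ne hik] using ih

theorem sum_count_run (h : ∀ m, mover A T (run A T c m) ≠ none) (m : ℕ) :
    ∑ i ∈ A, (run A T c m).count i = m := by
  induction m with
  | zero => simp [run]
  | succ m ih =>
    obtain ⟨k, hk⟩ := Option.ne_none_iff_exists'.1 (h m)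
    have hkA := (mem_pending.1 (mover_spec hk).1).1
    rw [run_succ_of_mover_eq_some hk, RunState.advance, Finset.sum_update_of_mem hkA,
      add_right_comm, ← Finset.sum_eq_add_sum_sdiff_singleton_of_mem hkA, ih]

theorem terminatesBy_of_round_le (h : ∀ m i, ((run A T c m).cfg.proc i).round ≤ R) :
    TerminatesBy A T c R := by
  suffices ∃ m, mover A T (run A T c m) = none by
    obtain ⟨m, hm⟩ := this
    exact ⟨m, pending_eq_empty_of_mover_eq_none hm, fun m' _ i _ => h m' i⟩
  by_contra! hmov
  have hle := Finset.sum_le_card_nsmul A _ _ fun i _ =>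
    count_run_le (i := i) h (A.card * (4 * R + 4) + 1)
  rw [sum_count_run hmov, smul_eq_mul] at hle
  omega

/-- The number of operations that a process in local state `p` executes before its first operation
in round `R` (`0` by truncation if it is already past it). -/
def opsBefore (p : ProcState) (R : ℕ) : ℕ := 4 * R - p.pos

/-- In a race given by the start and finish times of its participants `A`, some participant
finishes before any other one starts, or nobody ever starts. -/
def HasLead {ι : Type*} (A : Finset ι) (start finish : ι → EReal) : Prop :=
  (∃ i ∈ A, ∀ k ∈ A, k ≠ i → finish i < start k) ∨ ∀ i ∈ A, start i = ⊤

/-- Some process finishes its write in round `R` before any other process starts round `R`, or no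
process ever starts round `R`. -/
def Leads (A : Finset ℕ) (T : ℕ → ℕ → EReal) (c : Config) (R : ℕ) : Prop :=
  HasLead A (fun i => T i (opsBefore (c.proc i) R + 1)) fun i => T i (opsBefore (c.proc i) R + 3)

theorem count_run_eq_opsBefore (hR : (c.proc i).pos ≤ 4 * R) {m : ℕ}
    (hi : ((run A T c m).cfg.proc i).loc ≠ .decided)
    (hpos : ((run A T c m).cfg.proc i).pos = 4 * R) :
    (run A T c m).count i = opsBefore (c.proc i) R := by
  have hrun := pos_run m hi
  unfold opsBefore
  omega

theorem pos_run_le_of_no_start (hR : ∀ i, (c.proc i).round < R)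
    (hstart : ∀ i ∈ A, T i (opsBefore (c.proc i) R + 1) = ⊤) (m i : ℕ) :
    ((run A T c m).cfg.proc i).pos ≤ 4 * R := by
  refine run_induction (P := fun s => (s.cfg.proc i).pos ≤ 4 * R) (pos_lt_of_round_lt (hR i)).le
    (fun m k hk ih => ?_) m
  rcases eq_or_ne i k with rfl | hik
  · obtain ⟨hiA, hloc, htime⟩ := mem_pending.1 (mover_spec hk).1
    rw [RunState.advance, proc_step_self]
    refine (pos_localStep_le _ _).trans (ih.lt_of_ne fun hpos => htime ?_)
    rw [count_run_eq_opsBefore (pos_lt_of_round_lt (hR i)).le hloc hpos]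
    exact hstart i hiA
  · rwa [RunState.advance, proc_step_of_ne _ hik]

theorem pos_lt_of_aheadOf (hR : ∀ k, (c.proc k).round < R) (hi : i ∈ A) (hmono : Monotone (T i))
    (hlead : ∀ k ∈ A, k ≠ i →
      T i (opsBefore (c.proc i) R + 3) < T k (opsBefore (c.proc k) R + 1)) {m k : ℕ}
    (hahead : (run A T c m).cfg.AheadOf i R) (hk : mover A T (run A T c m) = some k)
    (hki : k ≠ i) : ((run A T c m).cfg.proc k).pos < 4 * R := by
  obtain ⟨hkA, hkloc, -⟩ := mem_pending.1 (mover_spec hk).1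
  refine (hahead.pos_le_of_ne k hki).lt_of_ne fun hpos => ?_
  have hnext : T i ((run A T c m).count i + 1) < T k ((run A T c m).count k + 1) := by
    rw [count_run_eq_opsBefore (pos_lt_of_round_lt (hR k)).le hkloc hpos]
    refine (hmono ?_).trans_lt (hlead k hkA hki)
    have hrun := pos_run m hahead.loc_ne_decided
    have hle := hahead.pos_le
    unfold opsBefore
    omega
  exact hnext.not_ge ((mover_spec hk).2 i (mem_pending.2 ⟨hi, hahead.loc_ne_decided, hnext.ne_top⟩))

theorem aheadOf_or_locked_run (hc : c.WellFormed) (hR : ∀ k, (c.proc k).round < R) (hi : i ∈ A)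
    (hloc : (c.proc i).loc ≠ .decided) (hmono : Monotone (T i))
    (hlead : ∀ k ∈ A, k ≠ i →
      T i (opsBefore (c.proc i) R + 3) < T k (opsBefore (c.proc k) R + 1)) (m : ℕ) :
    (run A T c m).cfg.AheadOf i R ∨ ∃ b, ∃ R' ≤ R, (run A T c m).cfg.Locked b R' := by
  refine run_induction (P := fun s => s.cfg.AheadOf i R ∨ ∃ b, ∃ R' ≤ R, s.cfg.Locked b R')
    (Or.inl (hc.aheadOf hR hloc)) (fun m k hk ih => ?_) m
  rcases ih with hahead | ⟨b, R', hR', hlocked⟩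
  · rcases eq_or_ne k i with rfl | hki
    · exact hahead.step_self (hc.run m)
    · exact Or.inl (hahead.step_of_ne hki (pos_lt_of_aheadOf hR hi hmono hlead hahead hk hki))
  · exact Or.inr ⟨b, R', hR', hlocked.step k⟩

theorem Leads.terminatesBy (h : Leads A T c R) (hc : c.WellFormed)
    (hR : ∀ i, (c.proc i).round < R) (hA : ∀ i ∈ A, (c.proc i).loc ≠ .decided)
    (hmono : ∀ i ∈ A, Monotone (T i)) : TerminatesBy A T c (R + 1) := by
  have round_le_of_pos_le {p : ProcState} (hp : p.pos ≤ 4 * R + 2) : p.round ≤ R + 1 := by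
    simp only [ProcState.pos] at hp
    omega
  refine terminatesBy_of_round_le fun m k => ?_
  rcases h with ⟨i, hi, hlead⟩ | hstart
  · rcases aheadOf_or_locked_run hc hR hi (hA i hi) (hmono i hi) hlead m with
      hahead | ⟨b, R', hR', hlocked⟩
    · rcases eq_or_ne k i with rfl | hki
      · exact round_le_of_pos_le hahead.pos_le
      · exact round_le_of_pos_le ((hahead.pos_le_of_ne k hki).trans (Nat.le_add_right _ 2))
    · exact (hlocked.committed k).round_le.trans (Nat.succ_le_succ hR')
  · exact round_le_of_pos_le ((pos_run_le_of_no_start hR hstart m k).trans (Nat.le_add_right _ 2))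

theorem Leads.extraRounds_le {r k : ℕ} (h : Leads A T c (r + k)) (hk : 1 ≤ k) (hc : c.WellFormed)
    (hr : ∀ i, (c.proc i).round ≤ r) (hA : ∀ i ∈ A, (c.proc i).loc ≠ .decided)
    (hmono : ∀ i ∈ A, Monotone (T i)) : extraRounds A T c r ≤ (k + 1 : ℕ) :=
  sInf_le ⟨k + 1, rfl, h.terminatesBy hc (fun i => (hr i).trans_lt (by omega)) hA hmono⟩

end Execution

/-! ## Lower tails of sums of independent variables -/

theorem exists_Iic_pos_Ici_pos_of_ne_dirac (F : Measure ℝ) [IsProbabilityMeasure F]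
    (h : ∀ x, F ≠ Measure.dirac x) :
    ∃ a b, a < b ∧ 0 < F.real (Set.Iic a) ∧ 0 < F.real (Set.Ici b) := by
  have measureReal_pos_of_mem_nhds {x : ℝ} (hx : x ∈ F.support) {s : Set ℝ} (hs : s ∈ nhds x) :
      0 < F.real s :=
    ENNReal.toReal_pos ((Measure.mem_support_iff_forall x).1 hx s hs).ne' (measure_ne_top _ _)
  obtain ⟨x, hx, y, hy, hxy⟩ : ∃ x ∈ F.support, ∃ y ∈ F.support, x < y := by
    obtain ⟨x, hx⟩ := Measure.nonempty_support (IsProbabilityMeasure.ne_zero F)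
    by_contra! hle
    refine h x ?_
    have hae : id =ᵐ[F] fun _ => x := by
      filter_upwards [Measure.support_mem_ae (μ := F)] with y hy
      exact le_antisymm (hle x hx y hy) (hle y hy x hx)
    rw [← Measure.map_id (μ := F), Measure.map_congr hae, Measure.map_const, measure_univ,
      one_smul]
  exact ⟨(2 * x + y) / 3, (x + 2 * y) / 3, by linarith,
    measureReal_pos_of_mem_nhds hx (Iic_mem_nhds (by linarith)),
    measureReal_pos_of_mem_nhds hy (Ici_mem_nhds (by linarith))⟩

theorem exists_half_le_Iic {κ : Type*} [Finite κ] (F : κ → Measure ℝ)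
    [∀ π, IsProbabilityMeasure (F π)] :
    ∃ x, 0 ≤ x ∧ ∀ π, 1 / 2 ≤ (F π).real (Set.Iic x) := by
  have half_le : ∀ π, ∀ᶠ x in Filter.atTop, 1 / 2 ≤ (F π).real (Set.Iic x) := fun π => by
    have htendsto := (ENNReal.tendsto_toReal (measure_ne_top (F π) _)).comp
      (tendsto_measure_Iic_atTop (F π))
    rw [measure_univ, ENNReal.toReal_one] at htendsto
    exact htendsto.eventually_const_le (by norm_num)
  exact ((Filter.eventually_ge_atTop 0).and (Filter.eventually_all.2 half_le)).exists

section LowerTail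

variable {Ω ι : Type*} [MeasurableSpace Ω] {μ : Measure Ω} [IsProbabilityMeasure μ] {Z : ι → Ω → ℝ}

theorem exchange_summand (hind : iIndepFun Z μ) (hm : ∀ i, Measurable (Z i))
    {I : Finset ι} {k : ι} (hk : k ∈ I) (a b s : ℝ) :
    μ.real {ω | Z k ω ≤ a} * μ.real {ω | ∑ i ∈ I, Z i ω ≤ s ∧ b ≤ Z k ω} ≤
      μ.real {ω | ∑ i ∈ I, Z i ω ≤ s - (b - a)} := by
  classical
  have hsplit : ∀ ω, ∑ i ∈ I, Z i ω = (∑ i ∈ I.erase k, Z i) ω + Z k ω := fun ω => by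
    rw [Finset.sum_apply, Finset.sum_erase_add I (fun i => Z i ω) hk]
  have hindep : IndepFun (Z k) (∑ j ∈ I.erase k, Z j) μ :=
    (hind.indepFun_finsetSum_of_notMem hm (Finset.notMem_erase k I)).symm
  calc μ.real {ω | Z k ω ≤ a} * μ.real {ω | ∑ i ∈ I, Z i ω ≤ s ∧ b ≤ Z k ω}
      ≤ μ.real (Z k ⁻¹' Set.Iic a) * μ.real ((∑ j ∈ I.erase k, Z j) ⁻¹' Set.Iic (s - b)) := by
        refine mul_le_mul_of_nonneg_left (measureReal_mono ?_) measureReal_nonneg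
        rintro ω ⟨hsum, hlarge⟩
        rw [hsplit] at hsum
        exact show _ ≤ s - b by linarith
    _ = μ.real (Z k ⁻¹' Set.Iic a ∩ (∑ j ∈ I.erase k, Z j) ⁻¹' Set.Iic (s - b)) := by
        simp only [measureReal_def, ← ENNReal.toReal_mul, hindep.measure_inter_preimage_eq_mul _ _
          measurableSet_Iic measurableSet_Iic]
    _ ≤ μ.real {ω | ∑ i ∈ I, Z i ω ≤ s - (b - a)} := by
        refine measureReal_mono ?_
        rintro ω ⟨hsmall, hrest⟩
        simp only [Set.mem_preimage, Set.mem_Iic] at hsmall hrest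
        simp only [Set.mem_ofPred_eq, hsplit]
        linarith

theorem measureReal_sum_indicator_le_exp (hind : iIndepFun Z μ) (hm : ∀ i, Measurable (Z i))
    {K : Finset ι} {b β : ℝ} (hβ : 0 ≤ β) (hb : ∀ k ∈ K, β ≤ μ.real {ω | b ≤ Z k ω}) :
    μ.real {ω | ∑ k ∈ K, (Set.Ici b).indicator (fun _ => (1 : ℝ)) (Z k ω) ≤ β / 2 * K.card} ≤
      Real.exp (-(β ^ 2 / 2 * K.card)) := by
  set g : ℝ → ℝ := (Set.Ici b).indicator fun _ => 1 with hg
  have hgm : Measurable g := measurable_const.indicator measurableSet_Ici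
  have le_integral : ∀ k ∈ K, β ≤ ∫ ω, g (Z k ω) ∂μ := fun k hk => by
    have hcomp : (fun ω => g (Z k ω)) = {ω | b ≤ Z k ω}.indicator fun _ => (1 : ℝ) := by
      ext ω
      simp only [hg, Set.indicator, Set.mem_Ici, Set.mem_ofPred_eq]
    rw [hcomp, integral_indicator_const _ (measurableSet_le measurable_const (hm k)), smul_eq_mul,
      mul_one]
    exact hb k hk
  let W : ι → Ω → ℝ := fun k ω => -g (Z k ω) - ∫ ω', -g (Z k ω') ∂μ
  have hW : iIndepFun W μ :=
    hind.comp (fun k x => -g x - ∫ ω', -g (Z k ω') ∂μ) fun k => hgm.neg.sub_const _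
  have subgaussian : ∀ k ∈ K, HasSubgaussianMGF (W k) ((‖(0 : ℝ) - (-1)‖₊ / 2) ^ 2) μ :=
    fun k _ => hasSubgaussianMGF_of_mem_Icc (hgm.comp (hm k)).neg.aemeasurable
      (ae_of_all _ fun ω => by by_cases h : b ≤ Z k ω <;> simp [hg, h])
  have hoeffding := HasSubgaussianMGF.measure_sum_ge_le_of_iIndepFun hW subgaussian
    (ε := β / 2 * K.card) (by positivity)
  refine (measureReal_mono fun ω hω => ?_).trans (hoeffding.trans (Real.exp_le_exp.2 ?_))
  · simp only [Set.mem_ofPred_eq, W, Finset.sum_sub_distrib, Finset.sum_neg_distrib, integral_neg]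
      at hω ⊢
    have hsum := Finset.card_nsmul_le_sum K _ _ le_integral
    rw [nsmul_eq_mul] at hsum
    linarith
  · rcases K.eq_empty_or_nonempty with rfl | hK
    · simp
    · have : (0 : ℝ) < K.card := by exact_mod_cast hK.card_pos
      simp only [sub_neg_eq_add, zero_add, nnnorm_one, one_div, inv_pow, Finset.sum_const,
        nsmul_eq_mul, NNReal.coe_mul, NNReal.coe_natCast, NNReal.coe_inv, NNReal.coe_pow,
        NNReal.coe_ofNat]
      refine le_of_eq ?_
      field_simp

theorem le_sum_measureReal_sum_le_and_ge (hind : iIndepFun Z μ) (hm : ∀ i, Measurable (Z i))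
    (I : Finset ι) {K : Finset ι} {b β : ℝ} (hβ : 0 ≤ β)
    (hb : ∀ k ∈ K, β ≤ μ.real {ω | b ≤ Z k ω}) (s : ℝ) :
    β / 2 * K.card * (μ.real {ω | ∑ i ∈ I, Z i ω ≤ s} - Real.exp (-(β ^ 2 / 2 * K.card))) ≤
      ∑ k ∈ K, μ.real {ω | ∑ i ∈ I, Z i ω ≤ s ∧ b ≤ Z k ω} := by
  set E : ι → Set Ω := fun k => {ω | ∑ i ∈ I, Z i ω ≤ s ∧ b ≤ Z k ω}
  set f : Ω → ℝ := fun ω => ∑ k ∈ K, (E k).indicator (fun _ => (1 : ℝ)) ω with hf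
  have hEm : ∀ k, MeasurableSet (E k) := fun k =>
    (measurableSet_le (Finset.measurable_sum _ fun i _ => hm i) measurable_const).inter
      (measurableSet_le measurable_const (hm k))
  have hint : ∀ k ∈ K, Integrable ((E k).indicator fun _ => (1 : ℝ)) μ := fun k _ =>
    (integrable_const _).indicator (hEm k)
  have hintegral : ∫ ω, f ω ∂μ = ∑ k ∈ K, μ.real (E k) := by
    rw [hf, integral_finsetSum _ hint]
    simp only [integral_indicator_const _ (hEm _), smul_eq_mul, mul_one]
  have hcover : μ.real {ω | ∑ i ∈ I, Z i ω ≤ s} ≤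
      μ.real {ω | β / 2 * K.card ≤ f ω} + Real.exp (-(β ^ 2 / 2 * K.card)) := by
    refine le_trans ?_ (add_le_add_right (measureReal_sum_indicator_le_exp hind hm hβ hb) _)
    refine (measureReal_mono fun ω hω => ?_).trans (measureReal_union_le _ _)
    rcases le_total (β / 2 * K.card)
      (∑ k ∈ K, (Set.Ici b).indicator (fun _ => (1 : ℝ)) (Z k ω)) with h | h
    · refine Or.inl (h.trans (Finset.sum_le_sum fun k _ => le_of_eq ?_))
      have hω : ∑ i ∈ I, Z i ω ≤ s := hω
      simp only [Set.indicator, E, Set.mem_Ici, Set.mem_ofPred_eq, hω, true_and]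
    · exact Or.inr h
  rw [← hintegral]
  refine le_trans ?_ (mul_meas_ge_le_integral_of_nonneg (ae_of_all _ fun ω =>
    Finset.sum_nonneg fun k _ => Set.indicator_nonneg (fun _ _ => zero_le_one) _)
    (integrable_finsetSum _ hint) (β / 2 * K.card))
  exact mul_le_mul_of_nonneg_left (sub_le_iff_le_add.2 hcover) (by positivity)

variable {I K : Finset ι} {a b α β : ℝ}

/- A sum that is at most `s` has, up to an exponentially small probability, many summands that are
at least `b`; exchanging one of them for a summand that is at most `a` lowers the sum by
`b - a`. -/
theorem lower_tail_shift (hind : iIndepFun Z μ) (hm : ∀ i, Measurable (Z i)) (hKI : K ⊆ I)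
    (hK : K.Nonempty) (hα : 0 ≤ α) (hβ : 0 ≤ β) (ha : ∀ k ∈ K, α ≤ μ.real {ω | Z k ω ≤ a})
    (hb : ∀ k ∈ K, β ≤ μ.real {ω | b ≤ Z k ω}) (s : ℝ) :
    α * β / 2 * (μ.real {ω | ∑ i ∈ I, Z i ω ≤ s} - Real.exp (-(β ^ 2 / 2 * K.card))) ≤
      μ.real {ω | ∑ i ∈ I, Z i ω ≤ s - (b - a)} := by
  set P := μ.real {ω | ∑ i ∈ I, Z i ω ≤ s} - Real.exp (-(β ^ 2 / 2 * K.card))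
  set Q := μ.real {ω | ∑ i ∈ I, Z i ω ≤ s - (b - a)}
  have hexchange : ∀ k ∈ K, α * μ.real {ω | ∑ i ∈ I, Z i ω ≤ s ∧ b ≤ Z k ω} ≤ Q := fun k hk =>
    (mul_le_mul_of_nonneg_right (ha k hk) measureReal_nonneg).trans
      (exchange_summand hind hm (hKI hk) a b s)
  have hK0 : (0 : ℝ) < K.card := by exact_mod_cast hK.card_pos
  refine le_of_mul_le_mul_left ?_ hK0
  calc K.card * (α * β / 2 * P) = α * (β / 2 * K.card * P) := by ring
    _ ≤ α * ∑ k ∈ K, μ.real {ω | ∑ i ∈ I, Z i ω ≤ s ∧ b ≤ Z k ω} :=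
        mul_le_mul_of_nonneg_left (le_sum_measureReal_sum_le_and_ge hind hm I hβ hb s) hα
    _ ≤ K.card * Q := by
        rw [Finset.mul_sum, ← nsmul_eq_mul]
        exact Finset.sum_le_card_nsmul _ _ _ hexchange

theorem lower_tail_shift_iterate (hind : iIndepFun Z μ) (hm : ∀ i, Measurable (Z i))
    (hKI : K ⊆ I) (hK : K.Nonempty) (hα : 0 ≤ α) (hβ : 0 ≤ β)
    (ha : ∀ k ∈ K, α ≤ μ.real {ω | Z k ω ≤ a}) (hb : ∀ k ∈ K, β ≤ μ.real {ω | b ≤ Z k ω}) (s : ℝ)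
    (m : ℕ) :
    (α * β / 2) ^ m * μ.real {ω | ∑ i ∈ I, Z i ω ≤ s} - m * Real.exp (-(β ^ 2 / 2 * K.card)) ≤
      μ.real {ω | ∑ i ∈ I, Z i ω ≤ s - m * (b - a)} := by
  have hκ0 : 0 ≤ α * β / 2 := by positivity
  have hκ1 : α * β / 2 ≤ 1 := by
    obtain ⟨k, hk⟩ := hK
    linarith [mul_le_one₀ ((ha k hk).trans measureReal_le_one) hβ
      ((hb k hk).trans measureReal_le_one)]
  set κ := α * β / 2
  set η := Real.exp (-(β ^ 2 / 2 * K.card))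
  have hη : 0 ≤ η := Real.exp_nonneg _
  induction m with
  | zero => simp
  | succ m ih =>
    calc κ ^ (m + 1) * μ.real {ω | ∑ i ∈ I, Z i ω ≤ s} - (m + 1 : ℕ) * η
        ≤ κ * (κ ^ m * μ.real {ω | ∑ i ∈ I, Z i ω ≤ s} - m * η - η) := by
          have := mul_le_of_le_one_left (mul_nonneg m.cast_add_one_pos.le hη) hκ1
          rw [pow_succ']
          push_cast
          linarith
      _ ≤ κ * (μ.real {ω | ∑ i ∈ I, Z i ω ≤ s - m * (b - a)} - η) := by gcongr
      _ ≤ μ.real {ω | ∑ i ∈ I, Z i ω ≤ s - m * (b - a) - (b - a)} :=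
          lower_tail_shift hind hm hKI hK hα hβ ha hb _
      _ = μ.real {ω | ∑ i ∈ I, Z i ω ≤ s - (m + 1 : ℕ) * (b - a)} := by
          push_cast
          ring_nf

end LowerTail

/-! ## A race between independent processes -/

section Race

variable {Ω ι : Type*} [MeasurableSpace Ω] {μ : Measure Ω} [IsProbabilityMeasure μ] {A : Finset ι}

theorem half_sum_le_measureReal_unique {a b : ι → Set Ω}
    (ha : ∀ i ∈ A, MeasurableSet (a i)) (hb : ∀ i ∈ A, MeasurableSet (b i))
    (hba : ∀ i ∈ A, b i ⊆ a i)
    (hind : ∀ i ∈ A, ∀ k ∈ A, k ≠ i → μ.real (b i ∩ a k) = μ.real (b i) * μ.real (a k))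
    (hsum : ∑ k ∈ A, μ.real (a k) ≤ 1 / 2) :
    (∑ i ∈ A, μ.real (b i)) / 2 ≤
      μ.real {ω | ∃ i ∈ A, ω ∈ b i ∧ ∀ k ∈ A, k ≠ i → ω ∉ a k} := by
  classical
  set G : ι → Set Ω := fun i => b i \ ⋃ k ∈ A.erase i, a k
  have hGm : ∀ i ∈ A, MeasurableSet (G i) := fun i hi =>
    (hb i hi).diff (Finset.measurableSet_biUnion _ fun k hk => ha k (Finset.mem_of_mem_erase hk))
  have hdisj : (A : Set ι).PairwiseDisjoint G := by
    intro i hi k _ hik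
    refine Set.disjoint_left.2 fun ω hωi hωk => hωk.2 ?_
    exact Set.mem_biUnion (Finset.mem_coe.2 (Finset.mem_erase.2 ⟨hik, hi⟩)) (hba i hi hωi.1)
  have half_le : ∀ i ∈ A, μ.real (b i) / 2 ≤ μ.real (G i) := fun i hi => by
    have hothers : μ.real (b i ∩ ⋃ k ∈ A.erase i, a k) ≤ μ.real (b i) / 2 := by
      calc μ.real (b i ∩ ⋃ k ∈ A.erase i, a k)
          ≤ ∑ k ∈ A.erase i, μ.real (b i ∩ a k) := by
            rw [Set.inter_iUnion₂]
            exact measureReal_biUnion_finset_le _ _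
        _ = μ.real (b i) * ∑ k ∈ A.erase i, μ.real (a k) := by
            rw [Finset.mul_sum]
            exact Finset.sum_congr rfl fun k hk =>
              hind i hi k (Finset.mem_of_mem_erase hk) (Finset.ne_of_mem_erase hk)
        _ ≤ μ.real (b i) * (1 / 2) :=
            mul_le_mul_of_nonneg_left ((Finset.sum_le_sum_of_subset_of_nonneg
              (Finset.erase_subset _ _) fun _ _ _ => measureReal_nonneg).trans hsum)
              measureReal_nonneg
        _ = μ.real (b i) / 2 := by ring
    have hsplit : μ.real (b i ∩ ⋃ k ∈ A.erase i, a k) + μ.real (G i) = μ.real (b i) :=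
      measureReal_inter_add_sdiff
        (Finset.measurableSet_biUnion _ fun k hk => ha k (Finset.mem_of_mem_erase hk))
    linarith
  calc (∑ i ∈ A, μ.real (b i)) / 2 ≤ ∑ i ∈ A, μ.real (G i) := by
        rw [Finset.sum_div]
        exact Finset.sum_le_sum half_le
    _ = μ.real (⋃ i ∈ A, G i) := (measureReal_biUnion_finset hdisj hGm).symm
    _ ≤ μ.real {ω | ∃ i ∈ A, ω ∈ b i ∧ ∀ k ∈ A, k ≠ i → ω ∉ a k} := by
        refine measureReal_mono (Set.iUnion₂_subset fun i hi ω hω => ⟨i, hi, hω.1, ?_⟩)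
        exact fun k hk hki hωk => hω.2
          (Set.mem_biUnion (Finset.mem_coe.2 (Finset.mem_erase.2 ⟨hki, hk⟩)) hωk)

theorem exists_threshold {f : ℝ → ℝ} (hf : Monotone f) {d t₀ t₁ y : ℝ} (hd : 0 < d)
    (h₀ : f t₀ < y) (h₁ : y ≤ f t₁) : ∃ t, y ≤ f t ∧ f (t - d) < y := by
  set s := {t | y ≤ f t}
  have hbdd : BddBelow s := ⟨t₀, fun t ht => (hf.reflect_lt (h₀.trans_le ht)).le⟩
  obtain ⟨t, ht, hlt⟩ := exists_lt_of_csInf_lt ⟨t₁, h₁⟩ (lt_add_of_pos_right (sInf s) (half_pos hd))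
  refine ⟨sInf s + d / 2, ht.trans (hf hlt.le), not_le.1 ?_⟩
  exact notMem_of_lt_csInf (s := s) (by linarith) hbdd

variable {S W : ι → Ω → EReal} {d ε η : ℝ}

theorem tendsto_measureReal_le_coe_atTop {Y : Ω → EReal} :
    Filter.Tendsto (fun t : ℝ => μ.real {ω | Y ω ≤ t}) Filter.atTop
      (nhds (μ.real {ω | Y ω < ⊤})) := by
  have hunion : ⋃ t : ℝ, {ω | Y ω ≤ t} = {ω | Y ω < ⊤} := by
    ext ω
    simp only [Set.mem_iUnion, Set.mem_ofPred_eq]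
    refine ⟨fun ⟨t, ht⟩ => ht.trans_lt (EReal.coe_lt_top t), fun h => ?_⟩
    obtain ⟨t, ht, -⟩ := EReal.lt_iff_exists_real_btwn.1 h
    exact ⟨t, ht.le⟩
  rw [← hunion]
  exact (ENNReal.tendsto_toReal (measure_ne_top _ _)).comp
    (tendsto_measure_iUnion_atTop fun t t' htt' ω hω => hω.trans (EReal.coe_le_coe_iff.2 htt'))

theorem tendsto_measureReal_le_coe_atBot {Y : Ω → EReal} (hY : Measurable Y)
    (hbot : ∀ ω, Y ω ≠ ⊥) :
    Filter.Tendsto (fun t : ℝ => μ.real {ω | Y ω ≤ t}) Filter.atBot (nhds 0) := by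
  have hinter : ⋂ t : ℝ, {ω | Y ω ≤ t} = ∅ := by
    refine Set.eq_empty_iff_forall_notMem.2 fun ω hω => ?_
    obtain ⟨t, -, ht⟩ := EReal.lt_iff_exists_real_btwn.1 (bot_lt_iff_ne_bot.2 (hbot ω))
    exact (Set.mem_iInter.1 hω t).not_gt ht
  rw [← measureReal_empty (μ := μ), ← hinter]
  exact (ENNReal.tendsto_toReal (measure_ne_top _ _)).comp
    (tendsto_measure_iInter_atBot
      (fun t => (measurableSet_le hY measurable_const).nullMeasurableSet)
      (fun t t' htt' ω hω => hω.trans (EReal.coe_le_coe_iff.2 htt')) ⟨0, measure_ne_top _ _⟩)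

theorem half_sum_le_measureReal_hasLead (hS : ∀ i ∈ A, Measurable (S i))
    (hW : ∀ i ∈ A, Measurable (W i))
    (hind : ∀ i ∈ A, ∀ k ∈ A, k ≠ i → IndepFun (fun ω => (S i ω, W i ω)) (S k) μ) {t : EReal}
    (ht : ∑ i ∈ A, μ.real {ω | S i ω ≤ t} ≤ 1 / 2) :
    (∑ i ∈ A, μ.real {ω | W i ω ≤ t ∧ S i ω ≤ t}) / 2 ≤
      μ.real {ω | HasLead A (fun i => S i ω) fun i => W i ω} := by
  refine (half_sum_le_measureReal_unique (fun i hi => measurableSet_le (hS i hi) measurable_const)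
    (fun i hi => (measurableSet_le (hW i hi) measurable_const).inter
      (measurableSet_le (hS i hi) measurable_const)) (fun i _ ω hω => hω.2)
    (fun i hi k hk hki => ?_) ht).trans (measureReal_mono ?_)
  · have hprod := (hind i hi k hk hki).measure_inter_preimage_eq_mul (Set.Iic t ×ˢ Set.Iic t)
      (Set.Iic t) (measurableSet_Iic.prod measurableSet_Iic) measurableSet_Iic
    have hpre : (fun ω => (S i ω, W i ω)) ⁻¹' Set.Iic t ×ˢ Set.Iic t =
        {ω | W i ω ≤ t ∧ S i ω ≤ t} := Set.ext fun _ => and_comm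
    rw [hpre] at hprod
    exact (congrArg ENNReal.toReal hprod).trans ENNReal.toReal_mul
  · rintro ω ⟨i, hi, hfinish, hothers⟩
    exact Or.inl ⟨i, hi, fun k hk hki => hfinish.1.trans_lt (not_le.1 (hothers k hk hki))⟩

theorem half_le_measureReal_forall_eq_top (hS : ∀ i ∈ A, Measurable (S i))
    (hle : ∀ t : ℝ, ∑ i ∈ A, μ.real {ω | S i ω ≤ t} ≤ 1 / 2) :
    1 / 2 ≤ μ.real {ω | ∀ i ∈ A, S i ω = ⊤} := by
  have hmeas : MeasurableSet {ω | ∀ i ∈ A, S i ω = ⊤} := by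
    have hinter : {ω | ∀ i ∈ A, S i ω = ⊤} = ⋂ i ∈ A, S i ⁻¹' {⊤} := by
      ext ω
      simp only [Set.mem_iInter, Set.mem_preimage, Set.mem_singleton_iff, Set.mem_ofPred_eq]
    rw [hinter]
    exact Finset.measurableSet_biInter _ fun i hi => hS i hi (measurableSet_singleton _)
  have hsum : ∑ i ∈ A, μ.real {ω | S i ω < ⊤} ≤ 1 / 2 :=
    le_of_tendsto' (tendsto_finsetSum _ fun i _ => tendsto_measureReal_le_coe_atTop) hle
  have hcompl : μ.real {ω | ∀ i ∈ A, S i ω = ⊤}ᶜ ≤ ∑ i ∈ A, μ.real {ω | S i ω < ⊤} := by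
    refine (measureReal_mono (fun ω hω => ?_) (measure_ne_top _ _)).trans
      (measureReal_biUnion_finset_le A _)
    simpa only [Set.mem_compl_iff, Set.mem_ofPred_eq, not_forall, exists_prop, Set.mem_iUnion,
      lt_top_iff_ne_top] using hω
  rw [probReal_compl_eq_one_sub hmeas] at hcompl
  linarith

theorem le_measureReal_hasLead (hS : ∀ i ∈ A, Measurable (S i)) (hW : ∀ i ∈ A, Measurable (W i))
    (hbot : ∀ i ∈ A, ∀ ω, S i ω ≠ ⊥)
    (hind : ∀ i ∈ A, ∀ k ∈ A, k ≠ i → IndepFun (fun ω => (S i ω, W i ω)) (S k) μ) (hd : 0 < d)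
    (hε0 : 0 ≤ ε) (hε1 : ε ≤ 1) (hη : A.card * η ≤ 1 / 4)
    (hshift : ∀ i ∈ A, ∀ t : ℝ, ε * (μ.real {ω | S i ω ≤ t} - η) ≤
      μ.real {ω | W i ω ≤ (t - d : ℝ) ∧ S i ω ≤ (t - d : ℝ)}) :
    ε / 8 ≤ μ.real {ω | HasLead A (fun i => S i ω) fun i => W i ω} := by
  set f : ℝ → ℝ := fun t => ∑ i ∈ A, μ.real {ω | S i ω ≤ t} with hf
  have hmono : Monotone f := fun t t' htt' => Finset.sum_le_sum fun i _ =>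
    measureReal_mono fun ω hω => hω.trans (EReal.coe_le_coe_iff.2 htt')
  by_cases hsome : ∃ t₁, 1 / 2 ≤ f t₁
  · obtain ⟨t₁, ht₁⟩ := hsome
    have hlim : Filter.Tendsto f Filter.atBot (nhds (∑ _ ∈ A, 0)) :=
      tendsto_finsetSum _ fun i hi => tendsto_measureReal_le_coe_atBot (hS i hi) (hbot i hi)
    rw [Finset.sum_const_zero] at hlim
    obtain ⟨t₀, ht₀⟩ := (hlim.eventually_lt_const one_half_pos).exists
    obtain ⟨t, hlarge, hsmall⟩ := exists_threshold hmono hd ht₀ ht₁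
    have hsum : ε * (f t - A.card * η) ≤
        ∑ i ∈ A, μ.real {ω | W i ω ≤ (t - d : ℝ) ∧ S i ω ≤ (t - d : ℝ)} := by
      rw [hf, ← nsmul_eq_mul, ← Finset.sum_const, ← Finset.sum_sub_distrib, Finset.mul_sum]
      exact Finset.sum_le_sum fun i hi => hshift i hi t
    refine le_trans ?_ (half_sum_le_measureReal_hasLead hS hW hind hsmall.le)
    linarith [mul_le_mul_of_nonneg_left (show 1 / 4 ≤ f t - A.card * η by linarith) hε0]
  · simp only [not_exists, not_le] at hsome
    calc ε / 8 ≤ 1 / 2 := by linarith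
      _ ≤ μ.real {ω | ∀ i ∈ A, S i ω = ⊤} :=
          half_le_measureReal_forall_eq_top hS fun t => (hsome t).le
      _ ≤ _ := measureReal_mono fun ω hω => Or.inr hω

end Race

/-! ## Repeated trials -/

theorem measure_and_le_mul_of_indepFun {Ω α β : Type*} {mΩ : MeasurableSpace Ω}
    {mα : MeasurableSpace α} {mβ : MeasurableSpace β} {μ : Measure Ω} [IsProbabilityMeasure μ]
    {W : Ω → α} {V : Ω → β} (hW : Measurable W) (hV : Measurable V) (hind : IndepFun W V μ)
    {P : Set α} (hP : MeasurableSet P) {G : Set (α × β)} (hG : MeasurableSet G) {q : ℝ≥0∞}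
    (hq : ∀ ω', μ {ω | (W ω', V ω) ∈ G} ≤ q) :
    μ {ω | W ω ∈ P ∧ (W ω, V ω) ∈ G} ≤ q * μ {ω | W ω ∈ P} := by
  have hPG : MeasurableSet (Prod.fst ⁻¹' P ∩ G) := (measurable_fst hP).inter hG
  have : IsProbabilityMeasure (μ.map V) := Measure.isProbabilityMeasure_map hV.aemeasurable
  have hfubini : μ {ω | W ω ∈ P ∧ (W ω, V ω) ∈ G} =
      ∫⁻ ω', μ.map V (Prod.mk (W ω') ⁻¹' (Prod.fst ⁻¹' P ∩ G)) ∂μ := by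
    rw [← lintegral_map (measurable_measure_prodMk_left hPG) hW, ← Measure.prod_apply hPG,
      ← (indepFun_iff_map_prod_eq_prod_map_map hW.aemeasurable hV.aemeasurable).1 hind,
      Measure.map_apply (hW.prodMk hV) hPG]
    rfl
  calc μ {ω | W ω ∈ P ∧ (W ω, V ω) ∈ G}
      = ∫⁻ ω', μ.map V (Prod.mk (W ω') ⁻¹' (Prod.fst ⁻¹' P ∩ G)) ∂μ := hfubini
    _ ≤ ∫⁻ ω', (W ⁻¹' P).indicator (fun _ => q) ω' ∂μ := by
        refine lintegral_mono fun ω' => ?_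
        rw [Measure.map_apply hV (measurable_prodMk_left hPG)]
        by_cases h : W ω' ∈ P
        · rw [Set.indicator_of_mem (Set.mem_preimage.2 h)]
          exact (measure_mono fun ω hω => hω.2).trans (hq ω')
        · have hempty : Prod.mk (W ω') ⁻¹' (Prod.fst ⁻¹' P ∩ G) = ∅ :=
            Set.eq_empty_iff_forall_notMem.2 fun v hv => h hv.1
          rw [hempty, Set.preimage_empty, measure_empty]
          exact zero_le
    _ = q * μ {ω | W ω ∈ P} := lintegral_indicator_const (hW hP) q

theorem measure_and_le_mul_of_indep {Ω : Type*} {m₁ m₂ mΩ : MeasurableSpace Ω} {μ : Measure Ω}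
    [IsProbabilityMeasure μ] (h₁ : m₁ ≤ mΩ) (h₂ : m₂ ≤ mΩ) (hind : Indep m₁ m₂ μ) {P : Set Ω}
    (hP : MeasurableSet[m₁] P) {G : Set (Ω × Ω)} (hG : MeasurableSet[m₁.prod m₂] G) {q : ℝ≥0∞}
    (hq : ∀ ω', μ {ω | (ω', ω) ∈ G} ≤ q) :
    μ {ω | ω ∈ P ∧ (ω, ω) ∈ G} ≤ q * μ P := by
  refine @measure_and_le_mul_of_indepFun Ω Ω Ω mΩ m₁ m₂ μ _ id id (measurable_id'' h₁)
    (measurable_id'' h₂) ?_ P hP G hG q hq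
  refine (@IndepFun_iff_Indep Ω Ω Ω mΩ m₁ m₂ id id μ).2 ?_
  rwa [MeasurableSpace.comap_id, MeasurableSpace.comap_id]

section GeometricTail

theorem le_tsum_ite_mul_lt {w : ℝ≥0∞} (hw : w ≠ 0) (y : ℝ≥0∞) :
    y ≤ ∑' k : ℕ, if k * w < y then w else 0 := by
  have min_le_sum : ∀ n : ℕ, min y (n * w) ≤ ∑ k ∈ Finset.range n, if k * w < y then w else 0 := by
    intro n
    induction n with
    | zero => simp
    | succ n ih =>
      rw [Finset.sum_range_succ]
      split_ifs with hlt
      · rw [min_eq_right hlt.le] at ih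
        calc min y ((n + 1 : ℕ) * w) ≤ n * w + w := by
              rw [Nat.cast_succ, add_one_mul]
              exact min_le_right _ _
          _ ≤ _ := add_le_add_left ih w
      · rw [min_eq_left (not_lt.1 hlt)] at ih
        rw [add_zero]
        exact (min_le_left _ _).trans ih
  by_contra! hlt
  obtain ⟨n, hn⟩ := ENNReal.exists_nat_mul_gt hw hlt.ne_top
  exact ((lt_min hlt hn).trans_le (min_le_sum n)).not_ge (ENNReal.sum_le_tsum _)

variable {Ω : Type*} [MeasurableSpace Ω] {μ : Measure Ω} {Y : Ω → ℝ≥0∞}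

theorem lintegral_le_div_one_sub_of_geometric_tail {w q : ℝ≥0∞} (hw : w ≠ 0)
    (htail : ∀ k : ℕ, μ {ω | k * w < Y ω} ≤ q ^ k) : ∫⁻ ω, Y ω ∂μ ≤ w / (1 - q) := by
  let E : ℕ → Set Ω := fun k => toMeasurable μ {ω | k * w < Y ω}
  calc ∫⁻ ω, Y ω ∂μ ≤ ∫⁻ ω, ∑' k : ℕ, (E k).indicator (fun _ => w) ω ∂μ := by
        refine lintegral_mono fun ω => (le_tsum_ite_mul_lt hw _).trans ?_
        refine ENNReal.tsum_le_tsum fun k => ?_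
        split_ifs with hlt
        · rw [Set.indicator_of_mem (subset_toMeasurable μ _ hlt)]
        · exact zero_le
    _ = ∑' k : ℕ, w * μ {ω | k * w < Y ω} := by
        have hE : ∀ k, MeasurableSet (E k) := fun k => measurableSet_toMeasurable _ _
        rw [lintegral_tsum fun k => (measurable_const.indicator (hE k)).aemeasurable]
        simp only [lintegral_indicator_const (hE _), E, measure_toMeasurable]
    _ ≤ ∑' k : ℕ, w * q ^ k := ENNReal.tsum_le_tsum fun k => mul_le_mul_right (htail k) w
    _ = w / (1 - q) := by rw [ENNReal.tsum_mul_left, ENNReal.tsum_geometric, div_eq_mul_inv]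

variable {w ε D : ℝ} {Q : ℕ}

theorem lintegral_le_of_geometric_tail (hw : 0 < w) (hε0 : 0 < ε) (hε1 : ε ≤ 1)
    (htail : ∀ k : ℕ, μ {ω | ENNReal.ofReal (k * w) < Y ω} ≤ ENNReal.ofReal (1 - ε) ^ k)
    (hQ : 1 ≤ ε * Q) (hD : w * Q ≤ D) : ∫⁻ ω, Y ω ∂μ ≤ ENNReal.ofReal D := by
  have htail' : ∀ k : ℕ, μ {ω | k * ENNReal.ofReal w < Y ω} ≤ ENNReal.ofReal (1 - ε) ^ k := by
    intro k
    rw [← ENNReal.ofReal_natCast, ← ENNReal.ofReal_mul k.cast_nonneg]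
    exact htail k
  have hsub : 1 - ENNReal.ofReal (1 - ε) = ENNReal.ofReal ε := by
    rw [← ENNReal.ofReal_one, ← ENNReal.ofReal_sub 1 (by linarith), sub_sub_cancel]
  refine (lintegral_le_div_one_sub_of_geometric_tail (ENNReal.ofReal_pos.2 hw).ne' htail').trans ?_
  rw [hsub, ← ENNReal.ofReal_div_of_pos hε0]
  refine ENNReal.ofReal_le_ofReal (le_trans ?_ hD)
  rw [div_le_iff₀ hε0]
  nlinarith

theorem measure_lt_le_exp_of_geometric_tail (hε1 : ε ≤ 1)
    (htail : ∀ k : ℕ, μ {ω | ENNReal.ofReal (k * w) < Y ω} ≤ ENNReal.ofReal (1 - ε) ^ k)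
    (hQ : 1 ≤ ε * Q) (hD0 : 0 < D) (hD : w * Q ≤ D) {x : ℝ} (hx : 0 ≤ x) :
    μ {ω | ENNReal.ofReal x < Y ω} ≤ ENNReal.ofReal (Real.exp (-(⌊x / D⌋₊ : ℝ))) := by
  set s := ⌊x / D⌋₊
  have hsx : ((s * Q : ℕ) : ℝ) * w ≤ x := by
    calc ((s * Q : ℕ) : ℝ) * w = s * (w * Q) := by
          push_cast
          ring
      _ ≤ s * D := by gcongr
      _ ≤ x := (le_div_iff₀ hD0).1 (Nat.floor_le (div_nonneg hx hD0.le))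
  calc μ {ω | ENNReal.ofReal x < Y ω} ≤ μ {ω | ENNReal.ofReal ((s * Q : ℕ) * w) < Y ω} :=
        measure_mono fun ω hω => (ENNReal.ofReal_le_ofReal hsx).trans_lt hω
    _ ≤ ENNReal.ofReal (1 - ε) ^ (s * Q) := htail _
    _ = ENNReal.ofReal ((1 - ε) ^ (s * Q)) := (ENNReal.ofReal_pow (by linarith) _).symm
    _ ≤ ENNReal.ofReal (Real.exp (-s)) := by
        refine ENNReal.ofReal_le_ofReal ?_
        calc (1 - ε) ^ (s * Q) ≤ Real.exp (-ε) ^ (s * Q) :=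
              pow_le_pow_left₀ (by linarith) (Real.one_sub_le_exp_neg ε) _
          _ = Real.exp (-(s * (ε * Q))) := by
              rw [← Real.exp_nat_mul]
              push_cast
              ring_nf
          _ ≤ Real.exp (-s) := Real.exp_le_exp.2
              (neg_le_neg (le_mul_of_one_le_right s.cast_nonneg hQ))

end GeometricTail

theorem exists_length_le_log_mul_exp_le_one {ν K : ℝ} (hν : 0 < ν) (hK : 0 < K) :
    ∃ C, 0 < C ∧ ∀ n : ℕ, 2 ≤ n →
      ∃ l : ℕ, l + 1 ≤ C * Real.log n ∧ n * (K * Real.exp (-(ν * (l + 1)))) ≤ 1 := by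
  have hlog2 : 0 < Real.log 2 := Real.log_pos one_lt_two
  refine ⟨(|Real.log K| / Real.log 2 + 1) / ν + 2 / Real.log 2, by positivity, fun n hn => ?_⟩
  have hn2 : (2 : ℝ) ≤ n := by exact_mod_cast hn
  have hlog : 1 ≤ Real.log n / Real.log 2 :=
    (one_le_div hlog2).2 (Real.log_le_log two_pos hn2)
  set x := (|Real.log K| + Real.log n) / ν with hx
  have hx0 : 0 ≤ x := div_nonneg (add_nonneg (abs_nonneg _) (Real.log_nonneg (by linarith))) hν.le
  refine ⟨⌈x⌉₊, ?_, ?_⟩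
  · calc (⌈x⌉₊ : ℝ) + 1 ≤ (|Real.log K| * 1 + Real.log n) / ν + 2 * 1 := by
          rw [mul_one, ← hx]
          linarith [Nat.ceil_lt_add_one hx0]
      _ ≤ (|Real.log K| * (Real.log n / Real.log 2) + Real.log n) / ν +
          2 * (Real.log n / Real.log 2) := by gcongr
      _ = _ := by ring
  · have hle : |Real.log K| + Real.log n ≤ ν * (⌈x⌉₊ + 1) := by
      have := (Nat.le_ceil x).trans (le_add_of_nonneg_right zero_le_one)
      rwa [hx, div_le_iff₀' hν] at this
    calc n * (K * Real.exp (-(ν * (⌈x⌉₊ + 1))))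
        = Real.exp (Real.log n + Real.log K - ν * (⌈x⌉₊ + 1)) := by
          rw [sub_eq_add_neg, Real.exp_add, Real.exp_add, Real.exp_log hK,
            Real.exp_log (by linarith), mul_assoc]
      _ ≤ 1 := Real.exp_le_one_iff.2 (by linarith [le_abs_self (Real.log K)])

/-! ## Noisy schedules -/

section Elapsed

variable {Ω : Type*} (Δ : ℕ → ℕ → ℝ) (X : ℕ → ℕ → Ω → ℝ) (H : ℕ → ℕ → Ω → EReal)

/-- The time that process `i` needs for the `k` operations that follow its `N`-th one. -/
noncomputable def elapsed (ω : Ω) (i N k : ℕ) : EReal :=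
  ∑ j ∈ Finset.Ioc N (N + k), ((Δ i j : EReal) + (X i j ω : EReal) + H i j ω)

theorem opTime_add (ω : Ω) (i N k : ℕ) :
    opTime Δ X H ω i (N + k) = opTime Δ X H ω i N + elapsed Δ X H ω i N k := by
  have hIcc : ∀ n, Finset.Icc 1 n = Finset.Ioc 0 n := Finset.Icc_add_one_left_eq_Ioc 0
  simp only [opTime, elapsed, hIcc, add_assoc,
    Finset.sum_Ioc_consecutive _ (Nat.zero_le N) (Nat.le_add_right N k)]

theorem opTime_eq_add_elapsed (ω : Ω) (i j : ℕ) :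
    opTime Δ X H ω i j = Δ i 0 + elapsed Δ X H ω i 0 j := by
  simpa [opTime] using opTime_add Δ X H ω i 0 j

theorem elapsed_succ (ω : Ω) (i N k : ℕ) : elapsed Δ X H ω i N (k + 1) =
    elapsed Δ X H ω i N k + (Δ i (N + k + 1) + X i (N + k + 1) ω + H i (N + k + 1) ω) :=
  Finset.sum_Ioc_succ_top (Nat.le_add_right N k) _

end Elapsed

section ScheduleSigma

variable {Ω : Type*} (A : Finset ℕ) (X : ℕ → ℕ → Ω → ℝ) (H : ℕ → ℕ → Ω → EReal)

/-- The family of noise and failure variables that `IsNoisySchedule` requires to be independent. -/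
def scheduleVar : (A × ℕ) ⊕ (A × ℕ) → Ω → EReal :=
  Sum.elim (fun q ω => X q.1 (q.2 + 1) ω) fun q ω => H q.1 (q.2 + 1) ω

/-- The label of a variable of `scheduleVar`: whether it is a failure variable, its process, and
its operation. -/
def scheduleIndex : (A × ℕ) ⊕ (A × ℕ) → Bool × ℕ × ℕ :=
  Sum.elim (fun q => (false, q.1, q.2 + 1)) fun q => (true, q.1, q.2 + 1)

/-- The `σ`-algebra generated by the noise and failure variables with labels in `S`. -/
@[reducible]
noncomputable def scheduleSigma (S : Set (Bool × ℕ × ℕ)) : MeasurableSpace Ω :=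
  ⨆ q ∈ scheduleIndex A ⁻¹' S, MeasurableSpace.comap (scheduleVar A X H q) inferInstance

variable {A X H} {S : Set (Bool × ℕ × ℕ)} {i j : ℕ}

theorem measurable_scheduleVar {q : (A × ℕ) ⊕ (A × ℕ)} (hq : scheduleIndex A q ∈ S) :
    Measurable[scheduleSigma A X H S] (scheduleVar A X H q) :=
  (comap_measurable _).mono (le_iSup₂_of_le (f := fun q _ =>
    MeasurableSpace.comap (scheduleVar A X H q) inferInstance) q hq le_rfl) le_rfl

theorem measurable_noise_scheduleSigma (hi : i ∈ A) (hj : 1 ≤ j) (hS : (false, i, j) ∈ S) :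
    Measurable[scheduleSigma A X H S] (X i j) := by
  obtain ⟨j, rfl⟩ := Nat.exists_eq_add_of_le' hj
  exact (measurable_scheduleVar (q := Sum.inl (⟨i, hi⟩, j)) hS).ereal_toReal

theorem measurable_halt_scheduleSigma (hi : i ∈ A) (hj : 1 ≤ j) (hS : (true, i, j) ∈ S) :
    Measurable[scheduleSigma A X H S] (H i j) := by
  obtain ⟨j, rfl⟩ := Nat.exists_eq_add_of_le' hj
  exact measurable_scheduleVar (q := Sum.inr (⟨i, hi⟩, j)) hS

theorem measurableSet_noise_le_and_halt_eq_zero (hi : i ∈ A) (hj : 1 ≤ j) (hS : ∀ b, (b, i, j) ∈ S)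
    (x : ℝ) :
    MeasurableSet[scheduleSigma A X H S] (X i j ⁻¹' Set.Iic x ∩ H i j ⁻¹' {0}) :=
  MeasurableSet.inter (measurable_noise_scheduleSigma hi hj (hS _) measurableSet_Iic)
    (measurable_halt_scheduleSigma hi hj (hS _) (measurableSet_singleton 0))

theorem measurable_elapsed_scheduleSigma (Δ : ℕ → ℕ → ℝ) {N k : ℕ} (hi : i ∈ A)
    (hS : ∀ b, ∀ j ∈ Finset.Ioc N (N + k), (b, i, j) ∈ S) :
    Measurable[scheduleSigma A X H S] fun ω => elapsed Δ X H ω i N k := by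
  refine Finset.measurable_sum _ fun j hj => ?_
  have hj1 : 1 ≤ j := Nat.one_le_of_lt (Finset.mem_Ioc.1 hj).1
  have hnoise := (measurable_noise_scheduleSigma (A := A) (X := X) (H := H) hi hj1
    (hS _ j hj)).coe_real_ereal
  exact (measurable_const.add hnoise).add (measurable_halt_scheduleSigma hi hj1 (hS _ j hj))

theorem measurableSet_sum_noise_le {N k : ℕ} (hi : i ∈ A)
    (hS : ∀ j ∈ Finset.Ioc N (N + k), (false, i, j) ∈ S) (s : ℝ) :
    MeasurableSet[scheduleSigma A X H S] {ω | ∑ j ∈ Finset.Ioc N (N + k), X i j ω ≤ s} :=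
  measurableSet_le (Finset.measurable_sum _ fun j hj => measurable_noise_scheduleSigma hi
    (Nat.one_le_of_lt (Finset.mem_Ioc.1 hj).1) (hS j hj)) measurable_const

theorem measurableSet_forall_halt_eq_zero {N k : ℕ} (hi : i ∈ A)
    (hS : ∀ j ∈ Finset.Ioc N (N + k), (true, i, j) ∈ S) :
    MeasurableSet[scheduleSigma A X H S] {ω | ∀ j ∈ Finset.Ioc N (N + k), H i j ω = 0} := by
  have hinter : {ω | ∀ j ∈ Finset.Ioc N (N + k), H i j ω = 0} =
      ⋂ j ∈ Finset.Ioc N (N + k), H i j ⁻¹' {0} := by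
    ext ω
    simp only [Set.mem_iInter, Set.mem_preimage, Set.mem_singleton_iff, Set.mem_ofPred_eq]
  rw [hinter]
  exact Finset.measurableSet_biInter _ fun j hj => measurable_halt_scheduleSigma hi
    (Nat.one_le_of_lt (Finset.mem_Ioc.1 hj).1) (hS j hj) (measurableSet_singleton 0)

end ScheduleSigma

namespace IsNoisySchedule

variable {Ω : Type*} [mΩ : MeasurableSpace Ω] {μ : Measure Ω} {F : OpType → Measure ℝ} {M p : ℝ}
  {c : Config} {A : Finset ℕ} {Δ : ℕ → ℕ → ℝ} {X : ℕ → ℕ → Ω → ℝ} {H : ℕ → ℕ → Ω → EReal}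
  {S T : Set (Bool × ℕ × ℕ)} {i N k : ℕ}

theorem scheduleVar_measurable (hS : IsNoisySchedule μ F M p c A Δ X H) :
    ∀ q, Measurable (scheduleVar A X H q)
  | .inl (i, j) => (hS.measurable_noise i i.2 (j + 1) j.succ_pos).coe_real_ereal
  | .inr (i, j) => hS.measurable_halt i i.2 (j + 1) j.succ_pos

theorem scheduleSigma_le (hS : IsNoisySchedule μ F M p c A Δ X H) (S : Set (Bool × ℕ × ℕ)) :
    scheduleSigma A X H S ≤ mΩ :=
  iSup₂_le fun q _ => (hS.scheduleVar_measurable q).comap_le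

theorem indep_scheduleSigma (hS : IsNoisySchedule μ F M p c A Δ X H) (h : Disjoint S T) :
    Indep (scheduleSigma A X H S) (scheduleSigma A X H T) μ :=
  indep_iSup_of_disjoint (fun q => (hS.scheduleVar_measurable q).comap_le) hS.indep (h.preimage _)

theorem iIndepFun_noise (hS : IsNoisySchedule μ F M p c A Δ X H) (hi : i ∈ A) :
    iIndepFun (fun n => X i (n + 1)) μ := by
  have hinj : Function.Injective fun n : ℕ => (Sum.inl (⟨i, hi⟩, n) : (A × ℕ) ⊕ (A × ℕ)) :=
    fun _ _ h => congrArg Prod.snd (Sum.inl.inj h)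
  exact (hS.indep.precomp hinj).comp (fun _ => EReal.toReal) fun _ => measurable_ereal_toReal

theorem iIndepFun_halt (hS : IsNoisySchedule μ F M p c A Δ X H) (hi : i ∈ A) :
    iIndepFun (fun n => H i (n + 1)) μ := by
  have hinj : Function.Injective fun n : ℕ => (Sum.inr (⟨i, hi⟩, n) : (A × ℕ) ⊕ (A × ℕ)) :=
    fun _ _ h => congrArg Prod.snd (Sum.inr.inj h)
  exact hS.indep.precomp hinj

theorem measureReal_inter (hS : IsNoisySchedule μ F M p c A Δ X H) (h : Disjoint S T)
    {s t : Set Ω} (hs : MeasurableSet[scheduleSigma A X H S] s)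
    (ht : MeasurableSet[scheduleSigma A X H T] t) : μ.real (s ∩ t) = μ.real s * μ.real t :=
  (congrArg ENNReal.toReal ((Indep_iff _ _ μ).1 (hS.indep_scheduleSigma h) s t hs ht)).trans
    ENNReal.toReal_mul

theorem measureReal_noise (hS : IsNoisySchedule μ F M p c A Δ X H) {j : ℕ} (hi : i ∈ A)
    (hj : 1 ≤ j) {s : Set ℝ} (hs : MeasurableSet s) :
    μ.real (X i j ⁻¹' s) = (F (opType (c.proc i).loc j)).real s := by
  rw [← hS.law_noise i hi j hj, map_measureReal_apply (hS.measurable_noise i hi j hj) hs]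

theorem measurable_elapsed (hS : IsNoisySchedule μ F M p c A Δ X H) (hi : i ∈ A) (N k : ℕ) :
    Measurable fun ω => elapsed Δ X H ω i N k :=
  (measurable_elapsed_scheduleSigma (S := Set.univ) Δ hi fun _ _ _ => Set.mem_univ _).mono
    (hS.scheduleSigma_le _) le_rfl

theorem sum_time_ne_bot (hS : IsNoisySchedule μ F M p c A Δ X H) (hi : i ∈ A) {J : Finset ℕ}
    (hJ : ∀ j ∈ J, 1 ≤ j) (ω : Ω) :
    ∑ j ∈ J, ((Δ i j : EReal) + (X i j ω : EReal) + H i j ω) ≠ ⊥ := by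
  refine Finset.sum_induction _ (· ≠ ⊥) (fun _ _ hx hy => EReal.add_ne_bot_iff.2 ⟨hx, hy⟩)
    EReal.zero_ne_bot fun j hj => EReal.add_ne_bot_iff.2 ⟨EReal.coe_ne_bot (_ + _), ?_⟩
  rcases hS.halt_eq i hi j (hJ j hj) ω with h | h <;> rw [h]
  · exact EReal.zero_ne_bot
  · exact top_ne_bot

theorem elapsed_ne_bot (hS : IsNoisySchedule μ F M p c A Δ X H) (hi : i ∈ A) (N k : ℕ) (ω : Ω) :
    elapsed Δ X H ω i N k ≠ ⊥ :=
  hS.sum_time_ne_bot hi (fun _ hj => Nat.one_le_of_lt (Finset.mem_Ioc.1 hj).1) ω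

theorem opTime_ne_bot (hS : IsNoisySchedule μ F M p c A Δ X H) (hi : i ∈ A) (j : ℕ) (ω : Ω) :
    opTime Δ X H ω i j ≠ ⊥ := by
  rw [opTime_eq_add_elapsed]
  exact EReal.add_ne_bot_iff.2 ⟨EReal.coe_ne_bot _, hS.elapsed_ne_bot hi 0 j ω⟩

theorem elapsed_eq_top (hS : IsNoisySchedule μ F M p c A Δ X H) (hi : i ∈ A) {ω : Ω}
    (h : ¬∀ j ∈ Finset.Ioc N (N + k), H i j ω = 0) : elapsed Δ X H ω i N k = ⊤ := by
  push Not at h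
  obtain ⟨j, hj, hne⟩ := h
  have hpos : ∀ j ∈ Finset.Ioc N (N + k), 1 ≤ j := fun _ hj =>
    Nat.one_le_of_lt (Finset.mem_Ioc.1 hj).1
  rw [elapsed, ← Finset.add_sum_erase _ _ hj, (hS.halt_eq i hi j (hpos j hj) ω).resolve_left hne,
    ← EReal.coe_add, EReal.coe_add_top]
  exact EReal.top_add_of_ne_bot
    (hS.sum_time_ne_bot hi (fun j hj => hpos j (Finset.mem_of_mem_erase hj)) ω)

theorem add_elapsed_le_iff (hS : IsNoisySchedule μ F M p c A Δ X H) (hi : i ∈ A) (N k : ℕ)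
    (x t : ℝ) (ω : Ω) : x + elapsed Δ X H ω i N k ≤ t ↔
      (∀ j ∈ Finset.Ioc N (N + k), H i j ω = 0) ∧
        ∑ j ∈ Finset.Ioc N (N + k), X i j ω ≤ t - x - ∑ j ∈ Finset.Ioc N (N + k), Δ i j := by
  by_cases hhalt : ∀ j ∈ Finset.Ioc N (N + k), H i j ω = 0
  · have hfinite : elapsed Δ X H ω i N k = Real.toEReal
        (∑ j ∈ Finset.Ioc N (N + k), Δ i j + ∑ j ∈ Finset.Ioc N (N + k), X i j ω) := by
      let coeHom : ℝ →+ EReal := ⟨⟨Real.toEReal, EReal.coe_zero⟩, EReal.coe_add⟩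
      rw [← Finset.sum_add_distrib]
      refine (Finset.sum_congr rfl fun j hj => ?_).trans (map_sum coeHom _ _).symm
      rw [hhalt j hj, add_zero, ← EReal.coe_add]
      rfl
    rw [hfinite, ← EReal.coe_add, EReal.coe_le_coe_iff, and_iff_right hhalt]
    constructor <;> intro h <;> linarith
  · rw [hS.elapsed_eq_top hi hhalt, EReal.coe_add_top]
    exact iff_of_false (not_le.2 (EReal.coe_lt_top t)) fun h => hhalt h.1

theorem add_elapsed_succ_le (hS : IsNoisySchedule μ F M p c A Δ X H) (hi : i ∈ A) {u : EReal}
    {s x₀ : ℝ} {ω : Ω} (hle : u + elapsed Δ X H ω i N k ≤ s) (hX : X i (N + k + 1) ω ≤ x₀)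
    (hH : H i (N + k + 1) ω = 0) : u + elapsed Δ X H ω i N (k + 1) ≤ (s + (M + x₀) : ℝ) := by
  have hΔ : Δ i (N + k + 1) ≤ M := (hS.delay_mem i hi _ (Nat.le_add_left _ _)).2
  rw [elapsed_succ, hH, add_zero, ← add_assoc, EReal.coe_add s, ← EReal.coe_add]
  exact add_le_add hle (EReal.coe_le_coe_iff.2 (add_le_add hΔ hX))

theorem ae_noise_nonneg (hS : IsNoisySchedule μ F M p c A Δ X H)
    (hnonneg : ∀ π, F π (Set.Iio 0) = 0) : ∀ᵐ ω ∂μ, ∀ i ∈ A, ∀ j, 1 ≤ j → 0 ≤ X i j ω := by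
  rw [Filter.eventually_all_finset]
  intro i hi
  refine ae_all_iff.2 fun j => Filter.eventually_imp_distrib_left.2 fun hj => ?_
  have hpre : {ω | ¬0 ≤ X i j ω} = X i j ⁻¹' Set.Iio 0 := Set.ext fun _ => not_le
  rw [ae_iff, hpre, ← Measure.map_apply (hS.measurable_noise i hi j hj) measurableSet_Iio,
    hS.law_noise i hi j hj, hnonneg]

theorem monotone_opTime (hS : IsNoisySchedule μ F M p c A Δ X H) (hi : i ∈ A) {ω : Ω}
    (hX : ∀ j, 1 ≤ j → 0 ≤ X i j ω) : Monotone (opTime Δ X H ω i) := by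
  refine monotone_nat_of_le_succ fun j => ?_
  have hhalt : 0 ≤ H i (j + 1) ω := by
    rcases hS.halt_eq i hi (j + 1) j.succ_pos ω with h | h <;> rw [h]
    exact le_top
  have hdelay : (0 : EReal) ≤ Δ i (j + 1) :=
    EReal.coe_nonneg.2 (hS.delay_mem i hi (j + 1) j.succ_pos).1
  have hnoise : (0 : EReal) ≤ X i (j + 1) ω := EReal.coe_nonneg.2 (hX (j + 1) j.succ_pos)
  simp only [opTime, Finset.sum_Icc_succ_top (Nat.le_add_left 1 j), ← add_assoc]
  rw [add_assoc, add_assoc]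
  exact le_add_of_nonneg_right (add_nonneg hdelay (add_nonneg hnoise hhalt))

end IsNoisySchedule

/-! ## Catching up during a block of rounds -/

/-- A read takes time at most `a`, and likewise at least `b > a`, with probability at least `q`;
and every operation takes time at most `x₀` with probability at least `1 / 2`. The first part says
quantitatively that the noise of a read is not concentrated on a point. -/
structure IsSpread (F : OpType → Measure ℝ) (a b q x₀ : ℝ) : Prop where
  pos : 0 < q
  lt : a < b
  le_Iic : q ≤ (F .read).real (Set.Iic a)
  le_Ici : q ≤ (F .read).real (Set.Ici b)
  nonneg : 0 ≤ x₀
  half_le_Iic : ∀ π, 1 / 2 ≤ (F π).real (Set.Iic x₀)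

theorem exists_isSpread (F : OpType → Measure ℝ) [∀ π, IsProbabilityMeasure (F π)]
    (hread : ∀ x, F .read ≠ Measure.dirac x) : ∃ a b q x₀, IsSpread F a b q x₀ := by
  have : Finite OpType := Finite.of_surjective (fun v : Bool => if v then .read else .write) fun
    | .read => ⟨true, rfl⟩
    | .write => ⟨false, rfl⟩
  obtain ⟨a, b, hab, ha, hb⟩ := exists_Iic_pos_Ici_pos_of_ne_dirac (F .read) hread
  obtain ⟨x₀, hx₀, hhalf⟩ := exists_half_le_Iic F
  exact ⟨a, b, _, x₀, lt_min ha hb, hab, min_le_left _ _, min_le_right _ _, hx₀, hhalf⟩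

theorem IsSpread.mul_self_div_two_le {F : OpType → Measure ℝ} [IsProbabilityMeasure (F .read)]
    {a b q x₀ : ℝ} (hF : IsSpread F a b q x₀) : q * q / 2 ≤ 1 / 2 := by
  have hq : q ≤ 1 := hF.le_Iic.trans measureReal_le_one
  nlinarith [hF.pos]

theorem half_pow_le_exp_neg_mul {ν : ℝ} (hν : ν ≤ 1 / 2) (l : ℕ) :
    (1 / 2 : ℝ) ^ (4 * l + 1) ≤ Real.exp (-(ν * (l + 1 : ℕ))) :=
  calc (1 / 2 : ℝ) ^ (4 * l + 1) ≤ (1 / 2 : ℝ) ^ (l + 1) :=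
        pow_le_pow_of_le_one (by norm_num) (by norm_num) (by omega)
    _ ≤ Real.exp (-(1 / 2)) ^ (l + 1) :=
        pow_le_pow_left₀ (by norm_num) (by linarith [Real.add_one_le_exp (-(1 / 2))]) _
    _ = Real.exp (-(1 / 2 * (l + 1 : ℕ))) := by rw [← Real.exp_nat_mul, mul_comm, neg_mul]
    _ ≤ Real.exp (-(ν * (l + 1 : ℕ))) := by gcongr

namespace IsNoisySchedule

variable {Ω : Type*} [mΩ : MeasurableSpace Ω] {μ : Measure Ω} [IsProbabilityMeasure μ]
  {F : OpType → Measure ℝ} {M p : ℝ} {c : Config} {A : Finset ℕ} {Δ : ℕ → ℕ → ℝ}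
  {X : ℕ → ℕ → Ω → ℝ} {H : ℕ → ℕ → Ω → EReal} {a b q x₀ : ℝ} {i N k l m : ℕ} {u : EReal}

theorem measureReal_halt_eq_zero (hS : IsNoisySchedule μ F M p c A Δ X H) (hp : 0 ≤ p)
    (hi : i ∈ A) {j : ℕ} (hj : 1 ≤ j) : μ.real (H i j ⁻¹' {0}) = 1 - p := by
  have hcompl : H i j ⁻¹' {0} = (H i j ⁻¹' {⊤})ᶜ := by
    ext ω
    rcases hS.halt_eq i hi j hj ω with h | h <;> simp [h]
  have htop : μ (H i j ⁻¹' {⊤}) = ENNReal.ofReal p := hS.prob_halt i hi j hj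
  rw [hcompl, probReal_compl_eq_one_sub (hS.measurable_halt i hi j hj (measurableSet_singleton ⊤)),
    measureReal_def, htop, ENNReal.toReal_ofReal hp]

theorem measureReal_forall_halt_eq_zero (hS : IsNoisySchedule μ F M p c A Δ X H) (hp : 0 ≤ p)
    (hi : i ∈ A) (N k : ℕ) :
    μ.real {ω | ∀ j ∈ Finset.Ioc N (N + k), H i j ω = 0} = (1 - p) ^ k := by
  have hinter : {ω | ∀ j ∈ Finset.Ioc N (N + k), H i j ω = 0} =
      ⋂ n ∈ Finset.Ico N (N + k), H i (n + 1) ⁻¹' {0} := by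
    ext ω
    simp only [← Finset.Ico_add_one_add_one_eq_Ioc, ← Finset.image_add_right_Ico,
      Finset.forall_mem_image, Set.mem_iInter, Set.mem_preimage, Set.mem_singleton_iff,
      Set.mem_ofPred_eq]
  rw [hinter, measureReal_def, (hS.iIndepFun_halt hi).measure_inter_preimage_eq_mul _ fun _ _ =>
    measurableSet_singleton 0, ENNReal.toReal_prod]
  exact (Finset.prod_congr rfl fun n _ => hS.measureReal_halt_eq_zero hp hi n.succ_pos).trans
    (by rw [Finset.prod_const, Nat.card_Ico, Nat.add_sub_cancel_left])

theorem measureReal_add_elapsed_le (hS : IsNoisySchedule μ F M p c A Δ X H) (hp : 0 ≤ p)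
    (hi : i ∈ A) (N k : ℕ) (x t : ℝ) :
    μ.real {ω | x + elapsed Δ X H ω i N k ≤ t} = (1 - p) ^ k *
      μ.real {ω | ∑ j ∈ Finset.Ioc N (N + k), X i j ω ≤
        t - x - ∑ j ∈ Finset.Ioc N (N + k), Δ i j} := by
  simp only [hS.add_elapsed_le_iff hi]
  have hdisj : Disjoint {s : Bool × ℕ × ℕ | s.1 = true} {s | s.1 = false} :=
    Set.disjoint_left.2 fun s h h' => Bool.false_ne_true (h'.symm.trans h)
  rw [Set.ofPred_and, hS.measureReal_inter hdisj
    (measurableSet_forall_halt_eq_zero hi fun _ _ => rfl)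
    (measurableSet_sum_noise_le hi (fun _ _ => rfl) _), hS.measureReal_forall_halt_eq_zero hp hi]

theorem sum_noise_lower_tail_shift (hS : IsNoisySchedule μ F M p c A Δ X H)
    (hF : IsSpread F a b q x₀) (hi : i ∈ A) (hN : ((c.proc i).loc.stage + N) % 4 = 0) (l m : ℕ)
    (s : ℝ) :
    (q * q / 2) ^ m * μ.real {ω | ∑ j ∈ Finset.Ioc N (N + (4 * l + 1)), X i j ω ≤ s} -
        m * Real.exp (-(q ^ 2 / 2 * (l + 1 : ℕ))) ≤
      μ.real {ω | ∑ j ∈ Finset.Ioc N (N + (4 * l + 1)), X i j ω ≤ s - m * (b - a)} := by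
  set reads : Finset ℕ := (Finset.range (l + 1)).image fun n => N + 4 * n with hreads
  have hcard : reads.card = l + 1 := by
    rw [hreads, Finset.card_image_of_injective _ fun x y h => by simpa using h, Finset.card_range]
  have hsub : reads ⊆ Finset.Ico N (N + (4 * l + 1)) := Finset.image_subset_iff.2 fun n hn => by
    rw [Finset.mem_range] at hn
    rw [Finset.mem_Ico]
    omega
  have hlaw : ∀ n ∈ reads, ∀ t : Set ℝ, MeasurableSet t →
      μ.real (X i (n + 1) ⁻¹' t) = (F .read).real t := fun n hn t ht => by
    obtain ⟨n, -, rfl⟩ := Finset.mem_image.1 hn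
    rw [hS.measureReal_noise hi (Nat.le_add_left _ _) ht, opType, if_neg (by omega)]
  have hsum : ∀ ω, ∑ j ∈ Finset.Ioc N (N + (4 * l + 1)), X i j ω =
      ∑ n ∈ Finset.Ico N (N + (4 * l + 1)), X i (n + 1) ω := fun ω => by
    rw [← Finset.Ico_add_one_add_one_eq_Ioc, Finset.sum_Ico_add' (fun j => X i j ω)]
  simp only [hsum, ← hcard]
  exact lower_tail_shift_iterate (hS.iIndepFun_noise hi)
    (fun n => hS.measurable_noise i hi _ n.succ_pos) hsub
    (Finset.card_pos.1 (hcard ▸ l.succ_pos)) hF.pos.le hF.pos.le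
    (fun n hn => hF.le_Iic.trans_eq (hlaw n hn _ measurableSet_Iic).symm)
    (fun n hn => hF.le_Ici.trans_eq (hlaw n hn _ measurableSet_Ici).symm) s m

theorem measureReal_add_elapsed_le_shift (hS : IsNoisySchedule μ F M p c A Δ X H)
    (hF : IsSpread F a b q x₀) (hp : p ∈ Set.Icc (0 : ℝ) 1) (hi : i ∈ A)
    (hN : ((c.proc i).loc.stage + N) % 4 = 0) (hu : u ≠ ⊥) (l m : ℕ) (t : ℝ) :
    (q * q / 2) ^ m * μ.real {ω | u + elapsed Δ X H ω i N (4 * l + 1) ≤ t} -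
        m * Real.exp (-(q ^ 2 / 2 * (l + 1 : ℕ))) ≤
      μ.real {ω | u + elapsed Δ X H ω i N (4 * l + 1) ≤ (t - m * (b - a) : ℝ)} := by
  induction u using EReal.rec with
  | bot => exact absurd rfl hu
  | top =>
    simp only [EReal.top_add_of_ne_bot (hS.elapsed_ne_bot hi _ _ _), top_le_iff, EReal.coe_ne_top,
      Set.ofPred_false, measureReal_empty, mul_zero]
    exact sub_nonpos.2 (by positivity)
  | coe x =>
    rw [hS.measureReal_add_elapsed_le hp.1 hi, hS.measureReal_add_elapsed_le hp.1 hi,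
      sub_right_comm t (m * (b - a)), sub_right_comm (t - x) (m * (b - a))]
    refine le_trans ?_ (mul_le_mul_of_nonneg_left (hS.sum_noise_lower_tail_shift hF hi hN l m _)
      (pow_nonneg (sub_nonneg.2 hp.2) _))
    have hsurvive : (1 - p) ^ (4 * l + 1) ≤ 1 :=
      pow_le_one₀ (sub_nonneg.2 hp.2) (by linarith [hp.1])
    have herror : 0 ≤ m * Real.exp (-(q ^ 2 / 2 * (l + 1 : ℕ))) := by positivity
    linarith [mul_le_of_le_one_left herror hsurvive]

theorem measureReal_div_four_le (hS : IsNoisySchedule μ F M p c A Δ X H) (hF : IsSpread F a b q x₀)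
    (hp0 : 0 ≤ p) (hp : p ≤ 1 / 2) (hi : i ∈ A) {n : ℕ} {E : Set Ω}
    (hE : MeasurableSet[scheduleSigma A X H {s | s.2.2 ≤ n}] E) :
    μ.real E / 4 ≤ μ.real (E ∩ (X i (n + 1) ⁻¹' Set.Iic x₀ ∩ H i (n + 1) ⁻¹' {0})) := by
  have hpast : Disjoint {s : Bool × ℕ × ℕ | s.2.2 ≤ n} {s | n < s.2.2} :=
    Set.disjoint_left.2 fun _ (h : _ ≤ n) => not_lt.2 h
  have hkind : Disjoint {s : Bool × ℕ × ℕ | s.1 = false} {s | s.1 = true} :=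
    Set.disjoint_left.2 fun s h h' => Bool.false_ne_true (h.symm.trans h')
  have hfast : MeasurableSet[scheduleSigma A X H {s | n < s.2.2}]
      (X i (n + 1) ⁻¹' Set.Iic x₀ ∩ H i (n + 1) ⁻¹' {0}) :=
    measurableSet_noise_le_and_halt_eq_zero hi n.succ_pos (fun _ => Nat.lt_succ_self n) x₀
  have hX : Measurable[scheduleSigma A X H {s | s.1 = false}] (X i (n + 1)) :=
    measurable_noise_scheduleSigma hi n.succ_pos rfl
  have hH : Measurable[scheduleSigma A X H {s | s.1 = true}] (H i (n + 1)) :=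
    measurable_halt_scheduleSigma hi n.succ_pos rfl
  rw [hS.measureReal_inter hpast hE hfast,
    hS.measureReal_inter hkind (hX measurableSet_Iic) (hH (measurableSet_singleton 0)),
    hS.measureReal_noise hi n.succ_pos measurableSet_Iic,
    hS.measureReal_halt_eq_zero hp0 hi n.succ_pos, div_eq_mul_one_div]
  refine mul_le_mul_of_nonneg_left ?_ measureReal_nonneg
  calc (1 / 4 : ℝ) = 1 / 2 * (1 / 2) := by norm_num
    _ ≤ _ := mul_le_mul (hF.half_le_Iic _) (by linarith) (by norm_num) measureReal_nonneg

theorem measureReal_div_sixteen_le (hS : IsNoisySchedule μ F M p c A Δ X H)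
    (hF : IsSpread F a b q x₀) (hp0 : 0 ≤ p) (hp : p ≤ 1 / 2) (hi : i ∈ A) (N k : ℕ) (u : EReal)
    (s : ℝ) : μ.real {ω | u + elapsed Δ X H ω i N k ≤ s} / 16 ≤
      μ.real {ω | u + elapsed Δ X H ω i N (k + 2) ≤ (s + (M + x₀) + (M + x₀) : ℝ) ∧
        u + elapsed Δ X H ω i N k ≤ s} := by
  have hE : MeasurableSet[scheduleSigma A X H {s | s.2.2 ≤ N + k}]
      {ω | u + elapsed Δ X H ω i N k ≤ s} :=
    measurableSet_le (measurable_const.add (measurable_elapsed_scheduleSigma Δ hi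
      fun _ _ hj => Set.mem_ofPred.2 (Finset.mem_Ioc.1 hj).2)) measurable_const
  have hle : N + k ≤ N + k + 1 := Nat.le_succ _
  have hE' : MeasurableSet[scheduleSigma A X H {s | s.2.2 ≤ N + k + 1}]
      {ω | u + elapsed Δ X H ω i N k ≤ s} :=
    measurableSet_le (measurable_const.add (measurable_elapsed_scheduleSigma Δ hi
      fun _ _ hj => (Finset.mem_Ioc.1 hj).2.trans hle)) measurable_const
  have hfast : MeasurableSet[scheduleSigma A X H {s | s.2.2 ≤ N + k + 1}]
      (X i (N + k + 1) ⁻¹' Set.Iic x₀ ∩ H i (N + k + 1) ⁻¹' {0}) :=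
    measurableSet_noise_le_and_halt_eq_zero hi (N + k).succ_pos (fun _ => le_refl (N + k + 1)) x₀
  have hfirst := hS.measureReal_div_four_le hF hp0 hp hi hE
  have hsecond := hS.measureReal_div_four_le hF hp0 hp hi (MeasurableSet.inter hE' hfast)
  have hsub : {ω | u + elapsed Δ X H ω i N k ≤ s} ∩
      (X i (N + k + 1) ⁻¹' Set.Iic x₀ ∩ H i (N + k + 1) ⁻¹' {0}) ∩
      (X i (N + k + 1 + 1) ⁻¹' Set.Iic x₀ ∩ H i (N + k + 1 + 1) ⁻¹' {0}) ⊆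
      {ω | u + elapsed Δ X H ω i N (k + 2) ≤ (s + (M + x₀) + (M + x₀) : ℝ) ∧
        u + elapsed Δ X H ω i N k ≤ s} := by
    rintro ω ⟨⟨hω, hX, hH⟩, hX', hH'⟩
    exact ⟨hS.add_elapsed_succ_le hi (hS.add_elapsed_succ_le hi hω hX hH) hX' hH', hω⟩
  linarith [measureReal_mono hsub (measure_ne_top μ _)]

theorem measureReal_add_elapsed_le_one_sub_pow (hS : IsNoisySchedule μ F M p c A Δ X H)
    (hp : 0 ≤ p) (hi : i ∈ A) (hu : u ≠ ⊥) (N k : ℕ) (t : ℝ) :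
    μ.real {ω | u + elapsed Δ X H ω i N k ≤ t} ≤ (1 - p) ^ k := by
  rw [← hS.measureReal_forall_halt_eq_zero hp hi N k]
  refine measureReal_mono fun ω hω => ?_
  by_contra hhalt
  rw [Set.mem_ofPred_eq, hS.elapsed_eq_top hi hhalt, EReal.add_top_of_ne_bot hu] at hω
  exact EReal.coe_ne_top t (top_le_iff.1 hω)

/- A process that begins a round by time `t` could have begun it `m * (b - a)` earlier, which leaves
it enough time to perform the first three operations of the round by time `t - 1`. -/
theorem measureReal_start_le_finish [IsProbabilityMeasure (F .read)]
    (hS : IsNoisySchedule μ F M p c A Δ X H)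
    (hF : IsSpread F a b q x₀) (hp : p ∈ Set.Icc (0 : ℝ) 1) (hi : i ∈ A)
    (hN : ((c.proc i).loc.stage + N) % 4 = 0) (hu : u ≠ ⊥)
    (hm : 1 + 2 * M + 2 * x₀ ≤ m * (b - a)) {η : ℝ}
    (hη : (m + 1) * Real.exp (-(q ^ 2 / 2 * (l + 1 : ℕ))) ≤ (q * q / 2) ^ m * η) (t : ℝ) :
    (q * q / 2) ^ m / 16 * (μ.real {ω | u + elapsed Δ X H ω i N (4 * l + 1) ≤ t} - η) ≤
      μ.real {ω | u + elapsed Δ X H ω i N (4 * l + 3) ≤ (t - 1 : ℝ) ∧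
        u + elapsed Δ X H ω i N (4 * l + 1) ≤ (t - 1 : ℝ)} := by
  set κ := (q * q / 2) ^ m
  set e := Real.exp (-(q ^ 2 / 2 * (l + 1 : ℕ)))
  have he : 0 ≤ e := Real.exp_nonneg _
  have hκ0 : 0 < κ := pow_pos (half_pos (mul_pos hF.pos hF.pos)) m
  rcases le_total p (1 / 2) with hp2 | hp2
  · have hM : 0 ≤ M := (Set.nonempty_Icc.1 ⟨_, hS.delay_mem i hi 1 le_rfl⟩)
    have hx₀ := hF.nonneg
    have hearly := hS.measureReal_add_elapsed_le_shift hF hp hi hN hu l m t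
    have hnext := hS.measureReal_div_sixteen_le hF hp.1 hp2 hi N (4 * l + 1) u (t - m * (b - a))
    refine le_trans (by linarith) (hnext.trans (measureReal_mono fun ω hω => ⟨?_, ?_⟩))
    · exact hω.1.trans (EReal.coe_le_coe_iff.2 (by linarith))
    · exact hω.2.trans (EReal.coe_le_coe_iff.2 (by linarith))
  · have hκ1 : κ ≤ 1 :=
      pow_le_one₀ (by nlinarith [hF.pos]) (hF.mul_self_div_two_le.trans (by norm_num))
    have hstart : μ.real {ω | u + elapsed Δ X H ω i N (4 * l + 1) ≤ t} ≤ e :=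
      (hS.measureReal_add_elapsed_le_one_sub_pow hp.1 hi hu N _ t).trans
        ((pow_le_pow_left₀ (sub_nonneg.2 hp.2) (by linarith) _).trans
          (half_pow_le_exp_neg_mul (by rw [sq]; exact hF.mul_self_div_two_le) l))
    have hη' : e ≤ η := by
      refine le_of_mul_le_mul_left ?_ hκ0
      nlinarith [mul_nonneg m.cast_nonneg he, mul_le_of_le_one_left he hκ1]
    exact (mul_nonpos_of_nonneg_of_nonpos (by positivity) (by linarith)).trans measureReal_nonneg

theorem le_measureReal_hasLead_elapsed [IsProbabilityMeasure (F .read)]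
    (hS : IsNoisySchedule μ F M p c A Δ X H)
    (hF : IsSpread F a b q x₀) (hp : p ∈ Set.Icc (0 : ℝ) 1) {N : ℕ → ℕ} {u : ℕ → EReal}
    (hN : ∀ i ∈ A, ((c.proc i).loc.stage + N i) % 4 = 0) (hu : ∀ i ∈ A, u i ≠ ⊥)
    (hm : 1 + 2 * M + 2 * x₀ ≤ m * (b - a)) {η : ℝ}
    (hη : (m + 1) * Real.exp (-(q ^ 2 / 2 * (l + 1 : ℕ))) ≤ (q * q / 2) ^ m * η)
    (hA : A.card * η ≤ 1 / 4) :
    (q * q / 2) ^ m / 128 ≤ μ.real {ω | HasLead A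
      (fun i => u i + elapsed Δ X H ω i (N i) (4 * l + 1))
      fun i => u i + elapsed Δ X H ω i (N i) (4 * l + 3)} := by
  have hmeas : ∀ i ∈ A, ∀ n, Measurable[scheduleSigma A X H {s | s.2.1 = i}] fun ω =>
      u i + elapsed Δ X H ω i (N i) n := fun i hi n =>
    measurable_const.add (measurable_elapsed_scheduleSigma Δ hi fun _ _ _ => rfl)
  have hind : ∀ i ∈ A, ∀ k ∈ A, k ≠ i → IndepFun
      (fun ω => (u i + elapsed Δ X H ω i (N i) (4 * l + 1),
        u i + elapsed Δ X H ω i (N i) (4 * l + 3)))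
      (fun ω => u k + elapsed Δ X H ω k (N k) (4 * l + 1)) μ := fun i hi k hk hki => by
    have hdisj : Disjoint {s : Bool × ℕ × ℕ | s.2.1 = i} {s | s.2.1 = k} :=
      Set.disjoint_left.2 fun s h h' => hki (h'.symm.trans h)
    exact indep_of_indep_of_le_left (indep_of_indep_of_le_right (hS.indep_scheduleSigma hdisj)
      (hmeas k hk _).comap_le) ((hmeas i hi _).prodMk (hmeas i hi _)).comap_le
  have hκ0 : 0 ≤ q * q / 2 := (half_pos (mul_pos hF.pos hF.pos)).le
  have hκ1 : (q * q / 2) ^ m ≤ 1 := pow_le_one₀ hκ0 (hF.mul_self_div_two_le.trans (by norm_num))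
  have hrace := le_measureReal_hasLead
    (fun i hi => (hmeas i hi _).mono (hS.scheduleSigma_le _) le_rfl)
    (fun i hi => (hmeas i hi _).mono (hS.scheduleSigma_le _) le_rfl)
    (fun i hi ω => EReal.add_ne_bot_iff.2 ⟨hu i hi, hS.elapsed_ne_bot hi _ _ _⟩) hind one_pos
    (div_nonneg (pow_nonneg hκ0 m) (by norm_num)) (by linarith) hA
    fun i hi => hS.measureReal_start_le_finish hF hp hi (hN i hi) (hu i hi) hm hη
  exact le_trans (by linarith) hrace

end IsNoisySchedule

/-! ## Geometric decay over the blocks -/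

theorem measurableSet_hasLead {ι α : Type*} {mα : MeasurableSpace α} {A : Finset ι}
    {S W : ι → α → EReal} (hS : ∀ i ∈ A, Measurable (S i)) (hW : ∀ i ∈ A, Measurable (W i)) :
    MeasurableSet {x | HasLead A (fun i => S i x) fun i => W i x} := by
  have hunion : {x | HasLead A (fun i => S i x) fun i => W i x} =
      (⋃ i ∈ A, ⋂ k ∈ A, ⋂ _ : k ≠ i, {x | W i x < S k x}) ∪ ⋂ i ∈ A, S i ⁻¹' {⊤} := by
    ext x
    simp only [HasLead, Set.mem_ofPred_eq, Set.mem_union, Set.mem_iUnion, Set.mem_iInter,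
      exists_prop, Set.mem_preimage, Set.mem_singleton_iff]
  rw [hunion]
  exact (Finset.measurableSet_biUnion _ fun i hi => Finset.measurableSet_biInter _ fun k hk =>
    MeasurableSet.iInter fun _ => measurableSet_lt (hW i hi) (hS k hk)).union
    (Finset.measurableSet_biInter _ fun i hi => hS i hi (measurableSet_singleton ⊤))

theorem opsBefore_add {p : ProcState} {R : ℕ} (h : p.round < R) (l : ℕ) :
    opsBefore p (R + l) = opsBefore p R + 4 * l := by
  have hpos := pos_lt_of_round_lt h
  unfold opsBefore
  omega

theorem stage_add_opsBefore_mod {p : ProcState} {R : ℕ} (h : p.round < R) :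
    (p.loc.stage + opsBefore p R) % 4 = 0 := by
  have hpos := pos_lt_of_round_lt h
  unfold opsBefore
  unfold ProcState.pos at *
  omega

section Blocks

variable {Ω : Type*} {A : Finset ℕ} {c : Config} {Δ : ℕ → ℕ → ℝ} {X : ℕ → ℕ → Ω → ℝ}
  {H : ℕ → ℕ → Ω → EReal} {i k l r R : ℕ}

/-- The labels of the variables that determine the times of all operations before round `R`. -/
def labelsBefore (c : Config) (R : ℕ) : Set (Bool × ℕ × ℕ) :=
  {s | s.2.2 ≤ opsBefore (c.proc s.2.1) R}

theorem measurable_opTime_scheduleSigma {j : ℕ} (hi : i ∈ A) (hj : j ≤ opsBefore (c.proc i) R) :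
    Measurable[scheduleSigma A X H (labelsBefore c R)] fun ω => opTime Δ X H ω i j := by
  simp only [opTime_eq_add_elapsed]
  refine measurable_const.add (measurable_elapsed_scheduleSigma Δ hi fun _ n hn => ?_)
  exact ((Finset.mem_Ioc.1 hn).2.trans_eq (zero_add j)).trans hj

theorem measurable_opTime_add_elapsed (hi : i ∈ A) (n : ℕ) :
    Measurable[(scheduleSigma A X H (labelsBefore c R)).prod
      (scheduleSigma A X H (labelsBefore c R)ᶜ)] fun z : Ω × Ω =>
      opTime Δ X H z.1 i (opsBefore (c.proc i) R) +
        elapsed Δ X H z.2 i (opsBefore (c.proc i) R) n :=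
  ((measurable_opTime_scheduleSigma hi le_rfl).comp measurable_fst).add
    ((measurable_elapsed_scheduleSigma Δ hi fun _ _ hj =>
      not_le.2 (Finset.mem_Ioc.1 hj).1).comp measurable_snd)

theorem measurableSet_forall_not_leads (hr : ∀ i, (c.proc i).round ≤ r) (l k : ℕ) :
    MeasurableSet[scheduleSigma A X H (labelsBefore c (r + 1 + k * (l + 1)))]
      {ω | ∀ m < k, ¬Leads A (opTime Δ X H ω) c (r + (m + 1) * (l + 1))} := by
  have hinter : {ω | ∀ m < k, ¬Leads A (opTime Δ X H ω) c (r + (m + 1) * (l + 1))} =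
      ⋂ m, ⋂ _ : m < k, {ω | Leads A (opTime Δ X H ω) c (r + (m + 1) * (l + 1))}ᶜ := by
    ext ω
    simp only [Set.mem_iInter, Set.mem_compl_iff, Set.mem_ofPred_eq]
  rw [hinter]
  refine MeasurableSet.iInter fun m => MeasurableSet.iInter fun hm => MeasurableSet.compl ?_
  have hround : (m + 1) * (l + 1) ≤ k * (l + 1) := Nat.mul_le_mul_right (l + 1) hm
  have hops : ∀ i, opsBefore (c.proc i) (r + (m + 1) * (l + 1)) + 3 ≤
      opsBefore (c.proc i) (r + 1 + k * (l + 1)) := fun i => by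
    have hblock : 0 < (m + 1) * (l + 1) := Nat.mul_pos m.succ_pos l.succ_pos
    have hpos := pos_lt_of_round_lt ((hr i).trans_lt (Nat.lt_add_of_pos_right hblock))
    unfold opsBefore
    omega
  exact measurableSet_hasLead
    (fun i hi => measurable_opTime_scheduleSigma hi (le_trans (by omega) (hops i)))
    fun i hi => measurable_opTime_scheduleSigma hi (hops i)

/-- In every block of `l + 1` rounds, whatever the times `u` at which the processes complete the
`N` operations that precede it, some process has a lead in the last round of the block with
probability at least `ε`. -/
def LeadsInBlocks [MeasurableSpace Ω] (μ : Measure Ω) (A : Finset ℕ) (c : Config)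
    (Δ : ℕ → ℕ → ℝ) (X : ℕ → ℕ → Ω → ℝ) (H : ℕ → ℕ → Ω → EReal) (l : ℕ) (ε : ℝ) : Prop :=
  ∀ (N : ℕ → ℕ) (u : ℕ → EReal), (∀ i ∈ A, ((c.proc i).loc.stage + N i) % 4 = 0) →
    (∀ i ∈ A, u i ≠ ⊥) → ε ≤ μ.real {ω | HasLead A
      (fun i => u i + elapsed Δ X H ω i (N i) (4 * l + 1))
      fun i => u i + elapsed Δ X H ω i (N i) (4 * l + 3)}

theorem leads_add_iff (hR : ∀ i, (c.proc i).round < R) (l : ℕ) (ω : Ω) :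
    Leads A (opTime Δ X H ω) c (R + l) ↔ HasLead A
      (fun i => opTime Δ X H ω i (opsBefore (c.proc i) R) +
        elapsed Δ X H ω i (opsBefore (c.proc i) R) (4 * l + 1))
      fun i => opTime Δ X H ω i (opsBefore (c.proc i) R) +
        elapsed Δ X H ω i (opsBefore (c.proc i) R) (4 * l + 3) := by
  simp only [Leads, opsBefore_add (hR _), ← opTime_add, add_assoc]

end Blocks

namespace IsNoisySchedule

variable {Ω : Type*} [mΩ : MeasurableSpace Ω] {μ : Measure Ω} [IsProbabilityMeasure μ]
  {F : OpType → Measure ℝ} {M p : ℝ} {c : Config} {A : Finset ℕ} {Δ : ℕ → ℕ → ℝ}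
  {X : ℕ → ℕ → Ω → ℝ} {H : ℕ → ℕ → Ω → EReal} {l r : ℕ} {ε : ℝ}

theorem measure_and_not_leads_le (hS : IsNoisySchedule μ F M p c A Δ X H)
    (hlead : LeadsInBlocks μ A c Δ X H l ε) {R : ℕ} (hR : ∀ i, (c.proc i).round < R) {P : Set Ω}
    (hP : MeasurableSet[scheduleSigma A X H (labelsBefore c R)] P) :
    μ {ω | ω ∈ P ∧ ¬Leads A (opTime Δ X H ω) c (R + l)} ≤ ENNReal.ofReal (1 - ε) * μ P := by
  have htime : ∀ n, ∀ i ∈ A, _ := fun n i hi =>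
    measurable_opTime_add_elapsed (Δ := Δ) (X := X) (H := H) (c := c) (R := R) hi n
  have htime_right : ∀ ω' n, ∀ i ∈ A, Measurable fun ω =>
      opTime Δ X H ω' i (opsBefore (c.proc i) R) +
        elapsed Δ X H ω i (opsBefore (c.proc i) R) n :=
    fun _ n i hi => measurable_const.add (hS.measurable_elapsed hi _ n)
  simp only [leads_add_iff hR]
  refine measure_and_le_mul_of_indep (hS.scheduleSigma_le _) (hS.scheduleSigma_le _)
    (hS.indep_scheduleSigma disjoint_compl_right) hP
    (measurableSet_hasLead (htime (4 * l + 1)) (htime (4 * l + 3))).compl fun ω' => ?_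
  have hblock := hlead _ _ (fun i _ => stage_add_opsBefore_mod (hR i))
    fun i hi => hS.opTime_ne_bot hi (opsBefore (c.proc i) R) ω'
  have hcompl := probReal_compl_eq_one_sub (μ := μ)
    (measurableSet_hasLead (htime_right ω' (4 * l + 1)) (htime_right ω' (4 * l + 3)))
  rw [← ofReal_measureReal]
  exact ENNReal.ofReal_le_ofReal (hcompl.trans_le (sub_le_sub_left hblock 1))

theorem measure_forall_not_leads_le (hS : IsNoisySchedule μ F M p c A Δ X H)
    (hlead : LeadsInBlocks μ A c Δ X H l ε) (hr : ∀ i, (c.proc i).round ≤ r) (k : ℕ) :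
    μ {ω | ∀ m < k, ¬Leads A (opTime Δ X H ω) c (r + (m + 1) * (l + 1))} ≤
      ENNReal.ofReal (1 - ε) ^ k := by
  induction k with
  | zero => exact prob_le_one.trans_eq (pow_zero _).symm
  | succ k ih =>
    have hR : ∀ i, (c.proc i).round < r + 1 + k * (l + 1) := fun i => by
      linarith [hr i, Nat.zero_le (k * (l + 1))]
    have hround : r + (k + 1) * (l + 1) = r + 1 + k * (l + 1) + l := by ring
    simp only [Nat.forall_lt_succ_right, hround, pow_succ']
    exact (hS.measure_and_not_leads_le hlead hR (measurableSet_forall_not_leads hr l k)).trans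
      (mul_le_mul_right ih _)

theorem measure_lt_extraRounds_le (hS : IsNoisySchedule μ F M p c A Δ X H)
    (hlead : LeadsInBlocks μ A c Δ X H l ε) (hnonneg : ∀ π, F π (Set.Iio 0) = 0)
    (hc : c.WellFormed) (hr : ∀ i, (c.proc i).round ≤ r)
    (hA : ∀ i ∈ A, (c.proc i).loc ≠ .decided) (k : ℕ) :
    μ {ω | ENNReal.ofReal (k * (2 * (l + 1))) < (extraRounds A (opTime Δ X H ω) c r : ℝ≥0∞)} ≤
      ENNReal.ofReal (1 - ε) ^ k := by
  refine (measure_mono_ae ?_).trans (hS.measure_forall_not_leads_le hlead hr k)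
  filter_upwards [hS.ae_noise_nonneg hnonneg] with ω hω hlt m hm hleads
  have hrounds : (extraRounds A (opTime Δ X H ω) c r : ℝ≥0∞) ≤ ((m + 1) * (l + 1) + 1 : ℕ) := by
    exact_mod_cast hleads.extraRounds_le (Nat.mul_pos m.succ_pos l.succ_pos) hc hr hA
      fun i hi => hS.monotone_opTime hi (hω i hi)
  have hblocks : (m + 1) * (l + 1) + 1 ≤ k * (2 * (l + 1)) := by
    nlinarith [Nat.mul_le_mul_right (l + 1) (Nat.succ_le_of_lt hm)]
  refine hlt.not_ge (hrounds.trans ?_)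
  rw [← ENNReal.ofReal_natCast]
  exact ENNReal.ofReal_le_ofReal (by exact_mod_cast hblocks)

end IsNoisySchedule

theorem exists_leadsInBlocks (F : OpType → Measure ℝ) [∀ π, IsProbabilityMeasure (F π)]
    (hread : ∀ x, F .read ≠ Measure.dirac x) (M : ℝ) :
    ∃ ε, 0 < ε ∧ ε ≤ 1 ∧ ∃ C, 0 < C ∧ ∀ n : ℕ, 2 ≤ n → ∃ l : ℕ, l + 1 ≤ C * Real.log n ∧
      ∀ {Ω : Type*} [MeasurableSpace Ω] {μ : Measure Ω} [IsProbabilityMeasure μ] {p : ℝ}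
        {c : Config} {A : Finset ℕ} {Δ : ℕ → ℕ → ℝ} {X : ℕ → ℕ → Ω → ℝ} {H : ℕ → ℕ → Ω → EReal},
        A.card = n → p ∈ Set.Icc (0 : ℝ) 1 → IsNoisySchedule μ F M p c A Δ X H →
        LeadsInBlocks μ A c Δ X H l ε := by
  obtain ⟨a, b, q, x₀, hF⟩ := exists_isSpread F hread
  obtain ⟨m, hm⟩ := exists_nat_ge ((1 + 2 * M + 2 * x₀) / (b - a))
  rw [div_le_iff₀ (sub_pos.2 hF.lt)] at hm
  have hq : 0 < q * q / 2 := half_pos (mul_pos hF.pos hF.pos)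
  have hκ : 0 < (q * q / 2) ^ m := pow_pos hq m
  have hκ1 : (q * q / 2) ^ m ≤ 1 :=
    pow_le_one₀ hq.le (hF.mul_self_div_two_le.trans (by norm_num))
  obtain ⟨C, hC, hlength⟩ := exists_length_le_log_mul_exp_le_one
    (K := 4 * (m + 1) / (q * q / 2) ^ m) (half_pos (pow_pos hF.pos 2)) (by positivity)
  refine ⟨(q * q / 2) ^ m / 128, by positivity, by linarith, C, hC, fun n hn => ?_⟩
  obtain ⟨l, hl, hsmall⟩ := hlength n hn
  refine ⟨l, hl, fun {Ω} _ μ _ p c A Δ X H hA hp hS N u hN hu => ?_⟩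
  refine hS.le_measureReal_hasLead_elapsed hF hp hN hu hm
    (η := (m + 1) * Real.exp (-(q ^ 2 / 2 * (l + 1 : ℕ))) / (q * q / 2) ^ m)
    (mul_div_cancel₀ _ hκ.ne').ge ?_
  rw [hA]
  push_cast
  calc _ = n * (4 * (m + 1) / (q * q / 2) ^ m * Real.exp (-(q ^ 2 / 2 * (l + 1)))) / 4 := by ring
    _ ≤ 1 / 4 := by gcongr

end NoisyConsensus

theorem mainTheorem1_general
    (F : NoisyConsensus.OpType → Measure ℝ) (hprob : ∀ π, IsProbabilityMeasure (F π))
    (hnonneg : ∀ π, F π (Set.Iio 0) = 0) (hread : ∀ x : ℝ, F .read ≠ Measure.dirac x) (M : ℝ) :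
    ∃ C : ℝ, 0 < C ∧
      ∀ p ∈ Set.Icc (0 : ℝ) 1, ∀ c : NoisyConsensus.Config, NoisyConsensus.Reachable c →
      ∀ r : ℕ, (∀ i, (c.proc i).round ≤ r) →
      ∀ A : Finset ℕ, 2 ≤ A.card → (∀ i ∈ A, (c.proc i).loc ≠ NoisyConsensus.Loc.decided) →
      ∀ (Ω : Type*) [MeasurableSpace Ω] (μ : Measure Ω) [IsProbabilityMeasure μ]
        (Δ : ℕ → ℕ → ℝ) (X : ℕ → ℕ → Ω → ℝ) (H : ℕ → ℕ → Ω → EReal),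
        NoisyConsensus.IsNoisySchedule μ F M p c A Δ X H →
        ∫⁻ ω, (NoisyConsensus.extraRounds A (NoisyConsensus.opTime Δ X H ω) c r : ℝ≥0∞) ∂μ
            ≤ ENNReal.ofReal (C * Real.log A.card) ∧
        ∀ k : ℝ, 0 ≤ k →
          μ {ω | ENNReal.ofReal k <
              (NoisyConsensus.extraRounds A (NoisyConsensus.opTime Δ X H ω) c r : ℝ≥0∞)}
            ≤ ENNReal.ofReal (Real.exp (-(⌊k / (C * Real.log A.card)⌋₊ : ℝ))) := by
  obtain ⟨ε, hε, hε1, C, hC, hblocks⟩ := NoisyConsensus.exists_leadsInBlocks F hread M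
  obtain ⟨Q, hQ⟩ := exists_nat_ge (1 / ε)
  have hQpos : (0 : ℝ) < Q := (one_div_pos.2 hε).trans_le hQ
  refine ⟨2 * C * Q, by positivity,
    fun p hp c hc r hr A hcard hA Ω _ μ _ Δ X H hS => ?_⟩
  obtain ⟨l, hl, hlead⟩ := hblocks A.card hcard
  have htail := hS.measure_lt_extraRounds_le (hlead rfl hp hS) hnonneg hc.wellFormed hr hA
  have hεQ : 1 ≤ ε * Q := (div_le_iff₀' hε).1 hQ
  have hlength : 2 * (l + 1) * (Q : ℝ) ≤ 2 * C * Q * Real.log A.card := by nlinarith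
  have hlog : 0 < Real.log A.card := Real.log_pos (by exact_mod_cast hcard)
  exact ⟨NoisyConsensus.lintegral_le_of_geometric_tail (by positivity) hε hε1 htail hεQ hlength,
    fun k hk => NoisyConsensus.measure_lt_le_exp_of_geometric_tail hε1 htail hεQ (by positivity)
      hlength hk⟩

theorem mainTheorem1
    (F : NoisyConsensus.OpType → Measure ℝ) (hprob : ∀ π, IsProbabilityMeasure (F π))
    (hnonneg : ∀ π, F π (Set.Iio 0) = 0) (hnonconst : ∀ π, ∀ x : ℝ, F π ≠ Measure.dirac x)
    (M : ℝ) (h : ℕ → ℝ) (hh : ∀ n, h n ∈ Set.Icc (0 : ℝ) 1) :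
    ∃ C : ℝ, 0 < C ∧
      ∀ n : ℕ, 2 ≤ n →
      ∀ (c : NoisyConsensus.Config), NoisyConsensus.Reachable c →
      ∀ r : ℕ, IsGreatest (Set.range fun i => (c.proc i).round) r →
      ∀ A : Finset ℕ, A.card = n → (∀ i ∈ A, (c.proc i).loc ≠ NoisyConsensus.Loc.decided) →
      ∀ (Ω : Type*) [MeasurableSpace Ω] (μ : Measure Ω) [IsProbabilityMeasure μ]
        (Δ : ℕ → ℕ → ℝ) (X : ℕ → ℕ → Ω → ℝ) (H : ℕ → ℕ → Ω → EReal),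
        NoisyConsensus.IsNoisySchedule μ F M (h n) c A Δ X H →
        ∫⁻ ω, (NoisyConsensus.extraRounds A (NoisyConsensus.opTime Δ X H ω) c r : ℝ≥0∞) ∂μ
            ≤ ENNReal.ofReal (C * Real.log n) ∧
        ∀ k : ℝ, 0 ≤ k →
          μ {ω | ENNReal.ofReal k <
              (NoisyConsensus.extraRounds A (NoisyConsensus.opTime Δ X H ω) c r : ℝ≥0∞)}
            ≤ ENNReal.ofReal (Real.exp (-(⌊k / (C * Real.log n)⌋₊ : ℝ))) := by
  obtain ⟨C, hC, hbounds⟩ := mainTheorem1_general F hprob hnonneg (hnonconst .read) M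
  refine ⟨C, hC, fun n hn c hc r hr A hA => ?_⟩
  subst hA
  exact hbounds _ (hh _) c hc r (fun i => hr.2 ⟨i, rfl⟩) A hn
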